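/- Let $d\ge 1$, $N\ge 0$ and $\sigma>0$. There is a constant $C_0>0$ depending only on $d$, $N$ and $\sigma$ such that the following holds. Setting. Let $\mathcal U\subseteq\mathbb R^n$ be an open convex set of states, $f_1,\dots,f_d:\mathcal U\to\mathbb R^n$ differentiable fluxes, and $S:\mathcal U\to\mathbb R$ a $C^2$ entropy with positive definite Hessian. Let $v(u)=\nabla S(u)$ be the entropy variables, $\mathcal V=v(\mathcal U)$, $u(\cdot):\mathcal V\to\mathcal U$ the inverse map, $F_i$ differentiable entropy fluxes with $v^T\,\partial f_i/\partial u=\partial F_i/\partial u$, and $\psi_i=v^Tf_i-F_i$ the entropy potentials. Let $D\subset\mathbb R^d$ be a closed nondegenerate simplex of diameter $h$ that contains a ball of radius $\rho>0$ with $h\le\sigma\rho$; let $\mathbf n$ be its outward unit normal. $P^N$ is the space of polynomials of total degree at most $N$ and $\Pi_N$ the (componentwise) $L^2(D)$ projection onto $P^N$. All integrals are exact. Let $u_h\in[P^N]^n$ take values in $\mathcal U$ on $D$, put $v_h=\Pi_N v(u_h)$, and assume that for every $x\in D$ the segment from $v(u_h(x))$ to $v_h(x)$ lies in $\mathcal V$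 (so that the entropy projection $\tilde u=u(v_h)$ is defined; $\tilde u$ and $f_i(\tilde u)$ are then differentiable on $D$). Let $v_h^+$ be arbitrary integrable exterior values on the faces of $D$, let $0\ne\mathbf v_0\in\mathbb R^d$ and $\beta=\operatorname{sign}(\mathbf v_0\cdot\mathbf n)$ on each face. The LDG gradient $\Theta_1,\dots,\Theta_d\in[P^N]^n$ is given by $$(\Theta_i,w)_D=-(v_h,\partial_{x_i}w)_D+\Big\langle\big(\tfrac12(v_h^++v_h)-\tfrac{\beta}{2}(v_h^+-v_h)\big)n_i,\,w\Big\rangle_{\partial D}\qquad\forall\, w\in[P^N]^n .$$ Let $K_{ij}(x)\in\mathbb R^{n\times n}$, $1\le i,j\le d$, be integrable on $D$ and satisfy, for all $x\in D$ and $T_1,\dots,T_d\in\mathbb R^n$, $$\sum_{i,j}T_i^TK_{ij}(x)T_j\ \ge\ \lambda_{\min}(x)\sum_i|T_i|^2$$ with $\lambda_{\min}>0$ and $\lambda_{\min}^{-1}\in L^\infty(D)$. Put $$\delta=\sum_{i=1}^d\Big(\int_D -f_i(u_h)^T\frac{\partial v_h}{\partial x_i}+\int_{\partial D}\psi_i(\tilde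 u)\,n_i\Big),\qquad \varepsilon=\frac{-\min(0,\delta)}{\int_D\sum_{i,j}\Theta_i^TK_{ij}\Theta_j}.$$ Let $\delta v=v(u_h)-\bar v$, where $\bar v$ is the mean of $v(u_h)$ over $D$, and let $\|\partial f_i/\partial v\|$ be the supremum of the spectral norm of the Jacobian of $w\mapsto f_i(u(w))$ over the segments from $v(u_h(x))$ to $v_h(x)$, $x\in D$, assumed finite. Conclusion. If the denominator of $\varepsilon$ vanishes, then so does its numerator (and then $\varepsilon:=0$), and $$\varepsilon\ \le\ C_0\,C(u_h)\,h,\qquad C(u_h)=\|\lambda_{\min}^{-1}\|_{L^\infty(D)}\sqrt{\sum_{i=1}^d\Big\|\frac{\partial f_i}{\partial v}\Big\|^2}\ \sqrt{\frac{\|\delta v\|_{L^2(D)}^2}{\|\Pi_N\delta v\|_{L^2(D)}^2}-1},$$ where for $\Pi_N\delta v=0$ the last factor is read as $0$, so that the claim is $\varepsilon\le 0$ in that case. -/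

import Mathlib

open MeasureTheory

noncomputable section

namespace ECAV

/-- `d`-dimensional Euclidean space. -/
abbrev E (d : ℕ) : Type := EuclideanSpace ℝ (Fin d)

/-! ### Conservation laws with a convex entropy -/

/-- A system of `n` conservation laws in `d` space dimensions, together with a strictly convex
entropy and the associated entropy fluxes, on a convex open set of admissible states. -/
structure EntropySystem (d n : ℕ) where
  /-- the admissible states -/
  states : Set (E n)
  isOpen_states : IsOpen states
  convex_states : Convex ℝ states
  /-- the fluxes `f₁, …, f_d` -/
  flux : Fin d → E n → E n
  differentiable_flux : ∀ m, DifferentiableOn ℝ (flux m) states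
  /-- the entropy `S` -/
  entropy : E n → ℝ
  contDiff_entropy : ContDiffOn ℝ 2 entropy states
  /-- the Hessian `∂v/∂u` of the entropy is positive definite -/
  hessian_pos : ∀ u ∈ states, ∀ w : E n, w ≠ 0 →
    0 < inner ℝ w (fderiv ℝ (fun z => gradient entropy z) u w)
  /-- the entropy fluxes `F₁, …, F_d` -/
  entropyFlux : Fin d → E n → ℝ
  differentiable_entropyFlux : ∀ m, DifferentiableOn ℝ (entropyFlux m) states
  /-- the compatibility condition `vᵀ ∂f_m/∂u = ∂F_m/∂u` -/
  compatibility : ∀ m, ∀ u ∈ states, ∀ w : E n,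
    inner ℝ (gradient entropy u) (fderiv ℝ (flux m) u w) = fderiv ℝ (entropyFlux m) u w

namespace EntropySystem

variable {d n : ℕ} (L : EntropySystem d n)

/-- The entropy variables `v(u) = ∂S/∂u`. -/
def entropyVar (u : E n) : E n := gradient L.entropy u

/-- The set of values of the entropy variables on admissible states. -/
def entropyStates : Set (E n) := L.entropyVar '' L.states

/-- The conservative variables `u(v)` as a function of the entropy variables: the inverse of
`v(u)` on the admissible states. -/
def conservativeVar : E n → E n := Function.invFunOn L.entropyVar L.states

/-- The entropy potential `ψ_m = vᵀ f_m - F_m`. -/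
def potential (m : Fin d) (u : E n) : ℝ :=
  inner ℝ (L.entropyVar u) (L.flux m u) - L.entropyFlux m u

/-- The Jacobian `∂f_m/∂v` at the point `w` of the space of entropy variables. -/
def fluxJacobian (m : Fin d) (w : E n) : E n →L[ℝ] E n :=
  fderiv ℝ (fun z => L.flux m (L.conservativeVar z)) w

end EntropySystem

/-! ### Polynomials, partial derivatives and the `L²` projection -/

/-- The partial derivative of `g` in the `i`-th coordinate direction. -/
def partialDeriv {d n : ℕ} (i : Fin d) (g : E d → E n) (x : E d) : E n :=
  fderiv ℝ g x (EuclideanSpace.single i 1)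

/-- `g ∈ P^N`: a scalar polynomial of total degree at most `N`. -/
def IsPoly {d : ℕ} (N : ℕ) (g : E d → ℝ) : Prop :=
  ∃ p : MvPolynomial (Fin d) ℝ, p.totalDegree ≤ N ∧ ∀ x : E d, g x = MvPolynomial.eval (fun i => x i) p

/-- `g ∈ [P^N]^n`: all components are polynomials of total degree at most `N`. -/
def IsVecPoly {d n : ℕ} (N : ℕ) (g : E d → E n) : Prop :=
  ∀ a : Fin n, IsPoly N (fun x => g x a)

/-- `p = Π_N g`, the (componentwise) `L²(D)` projection of `g` onto `[P^N]^n`. -/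
def IsL2Projection {d n : ℕ} (D : Set (E d)) (N : ℕ) (g p : E d → E n) : Prop :=
  IsVecPoly N p ∧ ∀ w : E d → ℝ, IsPoly N w → ∀ a : Fin n,
    ∫ x in D, p x a * w x = ∫ x in D, g x a * w x

/-- The squared `L²(D)` norm. -/
def normSqL2 {d n : ℕ} (D : Set (E d)) (g : E d → E n) : ℝ := ∫ x in D, ‖g x‖ ^ 2

/-! ### Simplicial elements

The element is the closed simplex `s.closedInterior`. Its faces are indexed by the opposite
vertex. -/

/-- The outward unit normal on the face opposite to vertex `j`: the direction from the vertex to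
its orthogonal projection on that face. -/
def outwardNormal {d : ℕ} [NeZero d] (s : Affine.Simplex ℝ (E d) d) (j : Fin (d + 1)) : E d :=
  (s.height j)⁻¹ • (s.altitudeFoot j - s.points j)

/-- The surface measure on the face opposite to vertex `j`: the `(d-1)`-dimensional Hausdorff
measure, normalized so as to agree with Lebesgue measure on `(d-1)`-dimensional flat pieces. -/
def faceMeasure {d : ℕ} [NeZero d] (s : Affine.Simplex ℝ (E d) d) (j : Fin (d + 1)) :
    Measure (E d) :=
  (μHE[d - 1]).restrict (s.faceOpposite j).closedInterior

/-- The size `h` of the element: its diameter. -/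
def elementSize {d : ℕ} (s : Affine.Simplex ℝ (E d) d) : ℝ := Metric.diam s.closedInterior

/-- Shape regularity with parameter `σ`: the element contains a ball of radius `ρ > 0` with
`h ≤ σ ρ`. -/
def ShapeRegular {d : ℕ} (s : Affine.Simplex ℝ (E d) d) (σ : ℝ) : Prop :=
  ∃ (c : E d) (ρ : ℝ), 0 < ρ ∧ elementSize s ≤ σ * ρ ∧ Metric.closedBall c ρ ⊆ s.closedInterior

/-! ### The LDG gradient -/

/-- The LDG parameter `β = sign(v₀ · n)` on the face opposite to vertex `j`. -/
def ldgBeta {d : ℕ} [NeZero d] (s : Affine.Simplex ℝ (E d) d) (v₀ : E d) (j : Fin (d + 1)) : ℝ :=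
  Real.sign (inner ℝ v₀ (outwardNormal s j))

/-- The average of interior and exterior values. -/
def avg {n : ℕ} (vint vext : E n) : E n := (1 / 2 : ℝ) • (vext + vint)

/-- The jump: exterior minus interior value. -/
def jump {n : ℕ} (vint vext : E n) : E n := vext - vint

/-- `Θ₁, …, Θ_d ∈ [P^N]^n` is the LDG gradient on the element `s` of the piecewise polynomial with
interior values `vh` and exterior values `vext j` on the face opposite to vertex `j`. -/
def IsLDGGradient {d n : ℕ} [NeZero d] (s : Affine.Simplex ℝ (E d) d) (N : ℕ) (v₀ : E d)
    (vh : E d → E n) (vext : Fin (d + 1) → E d → E n) (Θ : Fin d → E d → E n) : Prop :=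
  ∀ i : Fin d, IsVecPoly N (Θ i) ∧ ∀ w : E d → E n, IsVecPoly N w →
    ∫ x in s.closedInterior, inner ℝ (Θ i x) (w x) =
      (∫ x in s.closedInterior, inner ℝ (-vh x) (partialDeriv i w x)) +
      ∑ j : Fin (d + 1), ∫ x,
        inner ℝ (outwardNormal s j i •
          (avg (vh x) (vext j x) - (ldgBeta s v₀ j / 2) • jump (vh x) (vext j x))) (w x)
        ∂(faceMeasure s j)

/-! ### The ECAV coefficient and the constant in its bound -/

/-- The volume entropy residual `δ_k(u_h)`, where `vh = Π_N v(u_h)`; the entropy projection is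
`ũ = u(vh)`. -/
def entropyResidual {d n : ℕ} [NeZero d] (L : EntropySystem d n) (s : Affine.Simplex ℝ (E d) d)
    (uh vh : E d → E n) : ℝ :=
  ∑ i : Fin d,
    ((∫ x in s.closedInterior, inner ℝ (-L.flux i (uh x)) (partialDeriv i vh x)) +
      ∑ j : Fin (d + 1), ∫ x,
        L.potential i (L.conservativeVar (vh x)) * outwardNormal s j i ∂(faceMeasure s j))

/-- The quadratic form `∑_{i,j} Θ_iᵀ K_ij Θ_j` of the dissipation matrices. -/
def dissipationForm {d n : ℕ} (K : Fin d → Fin d → Matrix (Fin n) (Fin n) ℝ)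
    (Θ : Fin d → E n) : ℝ :=
  ∑ i : Fin d, ∑ j : Fin d, (Θ i).ofLp ⬝ᵥ (K i j).mulVec (Θ j).ofLp

/-- The viscous dissipation `∑_{i,j} (K_ij Θ_j, Θ_i)` over the element. -/
def viscousDissipation {d n : ℕ} (s : Affine.Simplex ℝ (E d) d)
    (K : E d → Fin d → Fin d → Matrix (Fin n) (Fin n) ℝ) (Θ : Fin d → E d → E n) : ℝ :=
  ∫ x in s.closedInterior, dissipationForm (K x) (fun i => Θ i x)

/-- The ECAV coefficient `ε_k(u_h)`. -/
def ecavCoefficient {d n : ℕ} [NeZero d] (L : EntropySystem d n) (s : Affine.Simplex ℝ (E d) d)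
    (K : E d → Fin d → Fin d → Matrix (Fin n) (Fin n) ℝ)
    (uh vh : E d → E n) (Θ : Fin d → E d → E n) : ℝ :=
  -min 0 (entropyResidual L s uh vh) / viscousDissipation s K Θ

/-- The deviation `δv = v(u_h) - v̄` of the entropy variables from their mean over the element. -/
def entropyDeviation {d n : ℕ} (L : EntropySystem d n) (s : Affine.Simplex ℝ (E d) d)
    (uh : E d → E n) (x : E d) : E n :=
  L.entropyVar (uh x) - ⨍ y in s.closedInterior, L.entropyVar (uh y)

/-- All entropy variables on the segments between `v(u_h)(x)` and `Π_N v(u_h)(x)`, for `x` in the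
element. -/
def entropySegments {d n : ℕ} (L : EntropySystem d n) (s : Affine.Simplex ℝ (E d) d)
    (uh vh : E d → E n) : Set (E n) :=
  ⋃ x ∈ s.closedInterior, segment ℝ (L.entropyVar (uh x)) (vh x)

/-- `‖∂f_i/∂v‖`: the supremum of the operator norm of the flux Jacobian over the segments between
the entropy variables and their projection. -/
def fluxJacobianNorm {d n : ℕ} (L : EntropySystem d n) (s : Affine.Simplex ℝ (E d) d)
    (uh vh : E d → E n) (i : Fin d) : ℝ :=
  sSup ((fun w => ‖L.fluxJacobian i w‖) '' entropySegments L s uh vh)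

/-- The factor `C(u_h)` of the bound; `lam` is the lower bound `λ_min` of the dissipation matrices
and `pδv = Π_N δv`. -/
def boundFactor {d n : ℕ} (L : EntropySystem d n) (s : Affine.Simplex ℝ (E d) d)
    (lam : E d → ℝ) (uh vh pδv : E d → E n) : ℝ :=
  (eLpNorm (fun x => (lam x)⁻¹) ⊤ (volume.restrict s.closedInterior)).toReal *
    Real.sqrt (∑ i : Fin d, fluxJacobianNorm L s uh vh i ^ 2) *
    Real.sqrt (normSqL2 s.closedInterior (entropyDeviation L s uh) /
      normSqL2 s.closedInterior pδv - 1)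

end ECAV

end

/-!
The bound rests on three estimates for `v_h = Π_N v(u_h)` on the simplex `D`, of diameter `h`.

*The residual.* In entropy variables the flux `f_i` is the gradient of the potential `ψ_i`
(`EntropySystem.hasFDerivAt_potential`), so by the divergence theorem the face terms of the entropy
residual equal `∑ ∫ ⟪f_i(ũ), ∂_i v_h⟫` (`entropyResidual_eq`). The mean value inequality along the
segments from `v(u_h)` to `v_h` and Cauchy-Schwarz bound the negative part of the residual by
`‖∂f/∂v‖ ‖v(u_h) - v_h‖ ‖∇v_h‖` (`neg_min_entropyResidual_le`), and by Pythagoras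
`‖v(u_h) - v_h‖² = ‖δv‖² - ‖Π_N δv‖²`.

*The LDG gradient.* Let `P` be the vertex opposite to a face on which `v₀ · n > 0`, let `e_l` be the
edges that issue from `P`, and `λ_l` the barycentric coordinate of the other end of `e_l`. The test
field `∑_l λ_l ∂_{e_l} v_h ⊗ e_l` lies in `[P^N]^{n × d}` and is tangential on all faces through `P`,
while on the remaining face the numerical flux is the interior value. Hence no face terms survive
and the exterior values are irrelevant: the degenerate energy `A = ∑ ∫ λ_l |∂_{e_l} v_h|²` equals the
pairing of `Θ` with the test field (`weightedEnergy_eq_integral`), so that `A ≤ h² ‖Θ‖²`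
(`weightedEnergy_le`).

*Norm equivalence.* On the standard simplex the energy `A` vanishes only for constant polynomials.
By finite dimensionality it controls `‖∂_{e_l} v_h‖²` and `‖v_h - v_h(P)‖²`, and an affine change of
variables multiplies all these integrals by the same factor (`exists_simplex_bound`). Shape
regularity enters only through `|∂_i λ_l| ≤ σ / h`, which gives `h² ‖∇v_h‖² ≤ c A`. Since also
`‖Π_N δv‖² ≤ c A`, the product `‖∇v_h‖ ‖Π_N δv‖` is at most `C h ‖Θ‖²`, and
`‖Θ‖² ≤ ‖λ_min⁻¹‖ ∫ ∑ Θᵢᵀ Kᵢⱼ Θⱼ` finishes the proof.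

The divergence theorem on a simplex with Hausdorff surface measure on the faces is proved here for
the direction of each edge: sweeping a face along an edge parametrizes the simplex, with Jacobian
`|n · e|` (`integral_sweep`), and sliding along the edge carries the face opposite to one end onto
the face opposite to the other end (`integral_slide`).
-/

open MeasureTheory

noncomputable section

namespace ECAV

/-! ### Hyperplanes and Fubini along a transversal direction -/

section Hyperplane

variable {V : Type*} [NormedAddCommGroup V] [InnerProductSpace ℝ V]

lemma isometry_add_coe_orthogonal (ν p : V) :
    Isometry (fun y : (Submodule.span ℝ {ν})ᗮ => p + (y : V)) :=
  (isometry_add_left p).comp isometry_subtype_coe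

lemma range_add_coe_orthogonal (ν p : V) :
    Set.range (fun y : (Submodule.span ℝ {ν})ᗮ => p + (y : V)) = {x | inner ℝ ν (x - p) = 0} := by
  ext x
  simp only [Set.mem_range, Set.mem_ofPred_eq]
  constructor
  · rintro ⟨y, rfl⟩
    simpa using Submodule.mem_orthogonal_singleton_iff_inner_right.1 y.2
  · intro h
    exact ⟨⟨x - p, Submodule.mem_orthogonal_singleton_iff_inner_right.2 h⟩, by simp⟩

variable [FiniteDimensional ℝ V] [MeasurableSpace V] [BorelSpace V]

/-- The Euclidean surface measure on the hyperplane through `p` with normal vector `ν`. -/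
def hyperplaneMeasure (ν p : V) : Measure V :=
  (volume : Measure (Submodule.span ℝ {ν})ᗮ).map (fun y : (Submodule.span ℝ {ν})ᗮ => p + (y : V))

instance (ν p : V) : SFinite (hyperplaneMeasure ν p) := by
  unfold hyperplaneMeasure; infer_instance

lemma hyperplaneMeasure_eq {ν : V} (hν : ν ≠ 0) (p : V) :
    hyperplaneMeasure ν p =
      (μHE[Module.finrank ℝ V - 1]).restrict {x | inner ℝ ν (x - p) = 0} := by
  have hr : Module.finrank ℝ (Submodule.span ℝ {ν})ᗮ = Module.finrank ℝ V - 1 := by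
    have := (Submodule.span ℝ {ν}).finrank_add_finrank_orthogonal
    rw [finrank_span_singleton hν] at this
    omega
  rw [hyperplaneMeasure, ← InnerProductSpace.euclideanHausdorffMeasure_eq_volume, hr,
    (isometry_add_coe_orthogonal ν p).map_euclideanHausdorffMeasure, range_add_coe_orthogonal]

instance (ν p : V) : IsFiniteMeasureOnCompacts (hyperplaneMeasure ν p) where
  lt_top_of_isCompact K hK := by
    rw [hyperplaneMeasure, Measure.map_apply (by fun_prop) hK.measurableSet]
    exact ((isometry_add_coe_orthogonal ν p).isClosedEmbedding.isCompact_preimage hK).measure_lt_top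

lemma ae_hyperplaneMeasure (ν p : V) :
    ∀ᵐ x ∂(hyperplaneMeasure ν p), inner ℝ ν (x - p) = 0 := by
  rw [hyperplaneMeasure, ae_map_iff (by fun_prop)
    (measurableSet_eq_fun (by fun_prop) (by fun_prop))]
  refine Filter.Eventually.of_forall fun y => ?_
  simpa using Submodule.mem_orthogonal_singleton_iff_inner_right.1 y.2

/-- Orthogonal Fubini: Lebesgue measure is the product of hyperplane measure and arc length along
the unit normal. -/
lemma measurePreserving_orthogonal {ν : V} (hν : ‖ν‖ = 1) (p : V) :
    MeasurePreserving (fun z : ℝ × (Submodule.span ℝ {ν})ᗮ => p + (z.2 : V) + z.1 • ν)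
      (volume.prod volume) volume := by
  have hν0 : ν ≠ 0 := by rintro rfl; simp at hν
  set S := Submodule.span ℝ {ν}
  have h1 : MeasurePreserving (fun t : ℝ => (⟨t • ν, Submodule.smul_mem _ _
      (Submodule.mem_span_singleton_self ν)⟩ : S)) volume volume := by
    let e := LinearIsometryEquiv.toSpanUnitSingleton (𝕜 := ℝ) ν hν
    exact e.measurePreserving
  have h2 := (h1.prod (MeasurePreserving.id (volume : Measure Sᗮ)))
  have h3 := (S.measurePreserving_measurableEquivProd (P := V) p).symm
  rw [InnerProductSpace.euclideanHausdorffMeasure_eq_volume] at h3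
  have h4 := h3.comp h2
  have h5 : (fun z : ℝ × Sᗮ => p + (z.2 : V) + z.1 • ν) =
      ⇑(S.measurableEquivProd p).symm ∘ Prod.map (fun t : ℝ => (⟨t • ν, Submodule.smul_mem _ _
        (Submodule.mem_span_singleton_self ν)⟩ : S)) id := by
    funext z
    simp only [Function.comp, Prod.map, id, Submodule.measurableEquivProd_symm_apply, vadd_eq_add]
    abel
  rw [h5]
  exact h4

/-- Oblique Fubini: sweeping a hyperplane along a transversal vector `e` gives Lebesgue measure,
up to the factor `|⟪ν, e⟫|`. -/
lemma map_sweep {ν : V} (hν : ‖ν‖ = 1) (p e : V) (he : inner ℝ ν e ≠ 0) :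
    ((volume : Measure ℝ).prod (hyperplaneMeasure ν p)).map (fun z => z.2 + z.1 • e) =
      ENNReal.ofReal |(inner ℝ ν e)⁻¹| • (volume : Measure V) := by
  set S := Submodule.span ℝ {ν}
  set α : ℝ := inner ℝ ν e with hα
  let e' : Sᗮ := ⟨e - α • ν, Submodule.mem_orthogonal_singleton_iff_inner_right.2 (by
    simp [inner_sub_right, inner_smul_right, hν, hα])⟩
  have hsk : MeasurePreserving (fun z : ℝ × Sᗮ => (α * z.1, z.2 + z.1 • e'))
      (volume.prod volume)
      ((ENNReal.ofReal |α⁻¹| • (volume : Measure ℝ)).prod (volume : Measure Sᗮ)) := by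
    refine MeasurePreserving.skew_product (f := fun t : ℝ => α * t)
      (g := fun t y => y + t • e') ⟨by fun_prop, Real.map_volume_mul_left he⟩ (by fun_prop) ?_
    exact Filter.Eventually.of_forall fun t => (measurePreserving_add_right volume _).map_eq
  have hor := measurePreserving_orthogonal hν p
  have hprod : (volume : Measure ℝ).prod (hyperplaneMeasure ν p) =
      ((volume : Measure ℝ).prod (volume : Measure Sᗮ)).map
        (fun z => (z.1, p + (z.2 : V))) := by
    have := Measure.map_prod_map (volume : Measure ℝ) (volume : Measure Sᗮ)
      (f := id) (g := fun y : Sᗮ => p + (y : V)) measurable_id (by fun_prop)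
    rw [Measure.map_id] at this
    exact this
  rw [hprod, Measure.map_map (by fun_prop) (by fun_prop)]
  have hcomp : ((fun z : ℝ × V => z.2 + z.1 • e) ∘ fun z : ℝ × Sᗮ => (z.1, p + (z.2 : V))) =
      (fun z : ℝ × Sᗮ => p + (z.2 : V) + z.1 • ν) ∘ (fun z => (α * z.1, z.2 + z.1 • e')) := by
    ext z
    simp only [Function.comp, e', Submodule.coe_add, Submodule.coe_smul]
    module
  rw [hcomp, ← Measure.map_map (by fun_prop) (by fun_prop), hsk.map_eq, Measure.prod_smul_left,
    Measure.map_smul, hor.map_eq]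

lemma volume_eq_map_sweep {ν : V} (hν : ‖ν‖ = 1) (p e : V) (he : inner ℝ ν e ≠ 0) :
    (volume : Measure V) = ENNReal.ofReal |inner ℝ ν e| •
      ((volume : Measure ℝ).prod (hyperplaneMeasure ν p)).map (fun z => z.2 + z.1 • e) := by
  rw [map_sweep hν p e he, smul_smul, ← ENNReal.ofReal_mul (abs_nonneg _), ← abs_mul,
    mul_inv_cancel₀ he]
  simp

lemma volume_sweep {ν : V} (hν : ‖ν‖ = 1) (p e : V) (he : inner ℝ ν e ≠ 0) {B : Set V}
    (hB : MeasurableSet B) :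
    volume B = ENNReal.ofReal |inner ℝ ν e| *
      ∫⁻ y, volume {t : ℝ | y + t • e ∈ B} ∂(hyperplaneMeasure ν p) := by
  conv_lhs => rw [volume_eq_map_sweep hν p e he]
  rw [Measure.smul_apply, Measure.map_apply (by fun_prop) hB, Measure.prod_apply_symm
    ((by fun_prop : Measurable fun z : ℝ × V => z.2 + z.1 • e) hB)]
  rfl

lemma integral_sweep {ν : V} (hν : ‖ν‖ = 1) (p e : V) (he : inner ℝ ν e ≠ 0) {G : V → ℝ}
    (hG : Integrable G) :
    ∫ x, G x = |inner ℝ ν e| * ∫ y, (∫ t : ℝ, G (y + t • e)) ∂(hyperplaneMeasure ν p) := by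
  have hm : Measurable fun z : ℝ × V => z.2 + z.1 • e := by fun_prop
  have hG' := hG
  rw [volume_eq_map_sweep hν p e he] at hG'
  have hG1 : Integrable G
      (((volume : Measure ℝ).prod (hyperplaneMeasure ν p)).map (fun z => z.2 + z.1 • e)) :=
    (integrable_smul_measure (by simpa using he) (by simp)).1 hG'
  conv_lhs => rw [volume_eq_map_sweep hν p e he]
  rw [integral_smul_measure, integral_map hm.aemeasurable hG1.1]
  rw [integral_prod_symm (fun z : ℝ × V => G (z.2 + z.1 • e))
    ((integrable_map_measure hG1.1 hm.aemeasurable).1 hG1)]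
  simp

/-- The measures `|⟪ν, e⟫| dσ` on hyperplanes transversal to `e` correspond to each other under the
projection along `e`: both measure the volume swept out per unit of `e`. -/
lemma map_oblique_projection {ν ν' : V} (hν : ‖ν‖ = 1) (hν' : ‖ν'‖ = 1) (p q e : V)
    (he : inner ℝ ν e ≠ 0) (he' : inner ℝ ν' e ≠ 0) :
    ENNReal.ofReal |inner ℝ ν' e| • (hyperplaneMeasure ν' q).map
        (fun x => x - (inner ℝ ν (x - p) / inner ℝ ν e) • e) =
      ENNReal.ofReal |inner ℝ ν e| • hyperplaneMeasure ν p := by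
  have hπ : Measurable (fun x : V => x - (inner ℝ ν (x - p) / inner ℝ ν e) • e) := by fun_prop
  have hτ : Measurable (fun x : V => inner ℝ ν (x - p) / inner ℝ ν e) := by fun_prop
  have hτs : ∀ (x : V) (t : ℝ), inner ℝ ν (x + t • e - p) / inner ℝ ν e =
      inner ℝ ν (x - p) / inner ℝ ν e + t := by
    intro x t
    rw [add_sub_right_comm, inner_add_right, inner_smul_right]
    field_simp
  ext A hA
  -- the part of the cylinder over `A` between the hyperplane at `p` and its translate by `e`
  let B : Set V := {x | x - (inner ℝ ν (x - p) / inner ℝ ν e) • e ∈ A ∧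
    inner ℝ ν (x - p) / inner ℝ ν e ∈ Set.Icc (0 : ℝ) 1}
  have hB : MeasurableSet B := (hπ hA).inter (hτ measurableSet_Icc)
  have hfib : ∀ y : V, volume {t : ℝ | y + t • e ∈ B} =
      A.indicator 1 (y - (inner ℝ ν (y - p) / inner ℝ ν e) • e) := by
    intro y
    have hset : {t : ℝ | y + t • e ∈ B} = {t : ℝ | y - (inner ℝ ν (y - p) / inner ℝ ν e) • e ∈ A ∧
        t ∈ Set.Icc (0 - inner ℝ ν (y - p) / inner ℝ ν e) (1 - inner ℝ ν (y - p) / inner ℝ ν e)} := by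
      ext t
      simp only [B, Set.mem_ofPred_eq, hτs, Set.mem_Icc]
      have : y + t • e - (inner ℝ ν (y - p) / inner ℝ ν e + t) • e =
        y - (inner ℝ ν (y - p) / inner ℝ ν e) • e := by module
      rw [this]
      constructor <;> rintro ⟨h1, h2, h3⟩ <;> exact ⟨h1, by linarith, by linarith⟩
    rw [hset]
    by_cases h : y - (inner ℝ ν (y - p) / inner ℝ ν e) • e ∈ A
    · simp only [h, true_and, Set.indicator_of_mem, Pi.one_apply]
      change volume (Set.Icc _ _) = _
      rw [Real.volume_Icc]; norm_num
    · simp [h]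
  have h1 := volume_sweep hν p e he hB
  have h2 := volume_sweep hν' q e he' hB
  simp_rw [hfib] at h1 h2
  have h3 : ∫⁻ y, A.indicator 1 (y - (inner ℝ ν (y - p) / inner ℝ ν e) • e)
      ∂(hyperplaneMeasure ν p) = hyperplaneMeasure ν p A := by
    rw [← lintegral_indicator_one hA]
    refine lintegral_congr_ae ?_
    filter_upwards [ae_hyperplaneMeasure ν p] with y hy
    simp [hy]
  have h4 : ∫⁻ y, A.indicator 1 (y - (inner ℝ ν (y - p) / inner ℝ ν e) • e)
      ∂(hyperplaneMeasure ν' q) = (hyperplaneMeasure ν' q).map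
        (fun x => x - (inner ℝ ν (x - p) / inner ℝ ν e) • e) A := by
    rw [← lintegral_indicator_one hA, lintegral_map (measurable_one.indicator hA) hπ]
  rw [h3] at h1
  rw [h4] at h2
  simp only [Measure.smul_apply, smul_eq_mul]
  rw [← h1, ← h2]

end Hyperplane

/-! ### Barycentric coordinates and faces of a simplex -/

section SimplexGeometry

variable {d : ℕ} (s : Affine.Simplex ℝ (E d) d)

/-- The vertices of a full-dimensional simplex as an affine basis. -/
def vertexBasis : AffineBasis (Fin (d + 1)) ℝ (E d) :=
  ⟨s.points, s.independent, s.independent.affineSpan_eq_top_iff_card_eq_finrank_add_one.2 (by simp)⟩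

/-- The barycentric coordinate `λ_j` belonging to the vertex `j`. -/
def bary (j : Fin (d + 1)) : E d →ᵃ[ℝ] ℝ := (vertexBasis s).coord j

lemma bary_point_self (j : Fin (d + 1)) : bary s j (s.points j) = 1 :=
  (vertexBasis s).coord_apply_eq j

lemma bary_point_ne {j k : Fin (d + 1)} (h : k ≠ j) : bary s j (s.points k) = 0 :=
  (vertexBasis s).coord_apply_ne h.symm

lemma sum_bary (x : E d) : ∑ j, bary s j x = 1 := (vertexBasis s).sum_coord_apply_eq_one x

lemma sum_bary_smul (x : E d) : ∑ j, bary s j x • s.points j = x :=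
  (vertexBasis s).linear_combination_coord_eq_self x

@[fun_prop]
lemma continuous_bary (j : Fin (d + 1)) : Continuous (bary s j) :=
  (bary s j).continuous_of_finiteDimensional

lemma closedInterior_eq : s.closedInterior = {x | ∀ j, 0 ≤ bary s j x} := by
  rw [← Affine.Simplex.convexHull_eq_closedInterior]
  exact (vertexBasis s).convexHull_eq_nonneg_coord

lemma mem_closedInterior_iff {x : E d} : x ∈ s.closedInterior ↔ ∀ j, 0 ≤ bary s j x := by
  rw [closedInterior_eq]; rfl

lemma bary_le_one {x : E d} (hx : x ∈ s.closedInterior) (j : Fin (d + 1)) : bary s j x ≤ 1 := by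
  rw [mem_closedInterior_iff] at hx
  rw [← sum_bary s x]
  exact Finset.single_le_sum (f := fun j => bary s j x) (fun i _ => hx i) (Finset.mem_univ j)

lemma interior_nonempty : (interior s.closedInterior).Nonempty := by
  rw [← Affine.Simplex.convexHull_eq_closedInterior]
  exact interior_convexHull_nonempty_iff_affineSpan_eq_top.2 (vertexBasis s).tot

lemma volume_closedInterior_lt_top : volume s.closedInterior < ⊤ :=
  s.isCompact_closedInterior.measure_lt_top

lemma measurableSet_closedInterior : MeasurableSet s.closedInterior :=
  s.isClosed_closedInterior.measurableSet

lemma integrableOn_closedInterior {F : Type*} [NormedAddCommGroup F] {f : E d → F}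
    (hf : ContinuousOn f s.closedInterior) : IntegrableOn f s.closedInterior :=
  hf.integrableOn_compact s.isCompact_closedInterior

lemma bary_add (j : Fin (d + 1)) (x w : E d) :
    bary s j (x + w) = bary s j x + (bary s j).linear w := by
  have := (bary s j).map_vadd x w
  rwa [vadd_eq_add, vadd_eq_add, add_comm, add_comm _ (bary s j x)] at this

lemma linear_bary_sub (j k l : Fin (d + 1)) :
    (bary s j).linear (s.points k - s.points l) =
      bary s j (s.points k) - bary s j (s.points l) :=
  (bary s j).linearMap_vsub _ _

lemma sum_linear_bary (w : E d) : ∑ j, (bary s j).linear w = 0 := by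
  have h := sum_bary s (0 + w)
  simp_rw [bary_add, Finset.sum_add_distrib, sum_bary] at h
  linarith

/-- Every vector is the combination of the edges issuing from a fixed vertex with the derivatives
of the barycentric coordinates as coefficients. -/
lemma sum_linear_bary_smul (j₀ : Fin (d + 1)) (w : E d) :
    ∑ j, (bary s j).linear w • (s.points j - s.points j₀) = w := by
  have h := sum_bary_smul s (0 + w)
  have h0 := sum_bary_smul s 0
  simp_rw [bary_add, add_smul, Finset.sum_add_distrib, h0, zero_add] at h
  simp_rw [smul_sub, Finset.sum_sub_distrib, ← Finset.sum_smul, sum_linear_bary, h]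
  simp

/-- Along the edge from `a` to `b` only the barycentric coordinates of `a` and `b` change. -/
lemma bary_add_smul_edge {a b : Fin (d + 1)} (hab : a ≠ b) (x : E d) (t : ℝ) (j : Fin (d + 1)) :
    bary s j (x + t • (s.points b - s.points a)) =
      if j = a then bary s a x - t else if j = b then bary s b x + t else bary s j x := by
  rw [bary_add, map_smul, smul_eq_mul, linear_bary_sub]
  split_ifs with h1 h2
  · rw [h1, bary_point_self, bary_point_ne s hab.symm]; ring
  · rw [h2, bary_point_self, bary_point_ne s hab]; ring
  · rw [bary_point_ne s (Ne.symm h1), bary_point_ne s (Ne.symm h2)]; ring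

variable [NeZero d]

lemma mem_faceOpposite_iff {x : E d} {j : Fin (d + 1)} :
    x ∈ (s.faceOpposite j).closedInterior ↔ x ∈ s.closedInterior ∧ bary s j x = 0 := by
  have hx := (vertexBasis s).affineCombination_coord_eq_self x
  have hs : ∑ i, bary s i x = 1 := sum_bary s x
  have h := s.affineCombination_mem_closedInterior_face_iff_nonneg
    (fs := {j}ᶜ) (m := d - 1) (by simp [Finset.card_compl]; have := NeZero.pos d; omega) hs
  rw [show (Finset.univ.affineCombination ℝ s.points fun i => bary s i x) = x from hx] at h
  refine h.trans ?_
  rw [mem_closedInterior_iff]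
  simp only [Finset.mem_compl, Finset.mem_singleton, not_not, forall_eq]
  constructor
  · rintro ⟨h1, h2⟩
    exact ⟨fun i => (eq_or_ne i j).elim (fun hi => by rw [hi, h2]) (h1 i), h2⟩
  · rintro ⟨h1, h2⟩
    exact ⟨fun i _ => h1 i, h2⟩

lemma norm_outwardNormal (j : Fin (d + 1)) : ‖outwardNormal s j‖ = 1 := by
  have := s.height_pos j
  rw [outwardNormal, norm_smul, Real.norm_eq_abs, abs_inv, abs_of_pos this, ← dist_eq_norm,
    dist_comm, ← Affine.Simplex.height]
  field_simp

lemma inner_outwardNormal_sub {j k : Fin (d + 1)} (h : j ≠ k) :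
    inner ℝ (outwardNormal s j) (s.points k - s.points j) = s.height j := by
  have h1 := s.inner_vsub_vsub_altitudeFoot_eq_height_sq h
  simp only [vsub_eq_sub] at h1
  have hp := s.height_pos j
  rw [outwardNormal, real_inner_smul_left, ← neg_sub (s.points j) (s.altitudeFoot j),
    ← neg_sub (s.points j) (s.points k), inner_neg_neg, real_inner_comm, h1]
  field_simp

/-- The outward normal is the negative gradient of the barycentric coordinate, scaled by the
height. -/
lemma linear_bary_eq (j : Fin (d + 1)) (w : E d) :
    (bary s j).linear w = -(inner ℝ (outwardNormal s j) w) / s.height j := by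
  have hp := s.height_pos j
  have h := congrArg (inner ℝ (outwardNormal s j)) (sum_linear_bary_smul s j w)
  rw [inner_sum, Finset.sum_congr rfl (g := fun k => (bary s k).linear w * s.height j -
    if k = j then (bary s k).linear w * s.height j else 0), Finset.sum_sub_distrib,
    ← Finset.sum_mul, sum_linear_bary, Finset.sum_ite_eq' Finset.univ] at h
  · rw [← h]; field_simp; simp
  · intro k _
    rw [real_inner_smul_right]
    by_cases hk : k = j
    · simp [hk]
    · simp [hk, inner_outwardNormal_sub s (Ne.symm hk)]

lemma inner_outwardNormal_eq (j : Fin (d + 1)) (w : E d) :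
    inner ℝ (outwardNormal s j) w = -s.height j * (bary s j).linear w := by
  have hp := s.height_pos j
  rw [linear_bary_eq]; field_simp

lemma inner_outwardNormal_edge_pos {a b : Fin (d + 1)} (hab : a ≠ b) :
    0 < inner ℝ (outwardNormal s a) (s.points b - s.points a) := by
  rw [inner_outwardNormal_sub s hab]
  exact s.height_pos a

lemma inner_outwardNormal_edge_neg {a b : Fin (d + 1)} (hab : a ≠ b) :
    inner ℝ (outwardNormal s b) (s.points b - s.points a) < 0 := by
  rw [← neg_sub, inner_neg_right, inner_outwardNormal_sub s hab.symm, neg_lt_zero]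
  exact s.height_pos b

/-- The hyperplane of a face is the zero set of the barycentric coordinate of the opposite
vertex. -/
lemma inner_outwardNormal_sub_eq_zero_iff {j k : Fin (d + 1)} (hk : k ≠ j) {x : E d} :
    inner ℝ (outwardNormal s j) (x - s.points k) = 0 ↔ bary s j x = 0 := by
  have hp := s.height_pos j
  have := bary_add s j (s.points k) (x - s.points k)
  rw [bary_point_ne s hk, zero_add, add_sub_cancel] at this
  rw [this, inner_outwardNormal_eq]
  simp [hp.ne']

lemma faceMeasure_eq {j k : Fin (d + 1)} (hk : k ≠ j) :
    faceMeasure s j =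
      (hyperplaneMeasure (outwardNormal s j) (s.points k)).restrict s.closedInterior := by
  have hn : outwardNormal s j ≠ 0 := by
    intro h
    simpa [h] using norm_outwardNormal s j
  rw [hyperplaneMeasure_eq hn, Measure.restrict_restrict (measurableSet_closedInterior s),
    faceMeasure, finrank_euclideanSpace_fin]
  congr 1
  ext x
  simp only [Set.mem_inter_iff, Set.mem_ofPred_eq]
  rw [inner_outwardNormal_sub_eq_zero_iff s hk]
  exact mem_faceOpposite_iff s

end SimplexGeometry

/-! ### The divergence theorem on a simplex -/

section Divergence

variable {d : ℕ} [NeZero d] (s : Affine.Simplex ℝ (E d) d)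

lemma ae_faceMeasure_mem (j : Fin (d + 1)) :
    ∀ᵐ x ∂(faceMeasure s j), x ∈ s.closedInterior ∧ bary s j x = 0 := by
  rw [faceMeasure, ae_restrict_iff' (s.faceOpposite j).isClosed_closedInterior.measurableSet]
  exact Filter.Eventually.of_forall fun x hx => (mem_faceOpposite_iff s).1 hx

lemma integrable_faceMeasure {F : Type*} [NormedAddCommGroup F] {f : E d → F}
    (hf : ContinuousOn f s.closedInterior) (j : Fin (d + 1)) : Integrable f (faceMeasure s j) := by
  obtain ⟨k, hk⟩ := exists_ne j
  rw [faceMeasure_eq s hk]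
  exact hf.integrableOn_compact s.isCompact_closedInterior

/-- Sliding along the edge from vertex `a` to vertex `b` maps the face opposite to `b` onto the
face opposite to `a`, and carries `|⟪n_b, e⟫| dσ` to `|⟪n_a, e⟫| dσ`. -/
lemma integral_slide {a b : Fin (d + 1)} (hab : a ≠ b) {f : E d → ℝ}
    (hf : ContinuousOn f s.closedInterior) :
    |inner ℝ (outwardNormal s b) (s.points b - s.points a)| *
        ∫ x, f (x + bary s a x • (s.points b - s.points a)) ∂(faceMeasure s b) =
      |inner ℝ (outwardNormal s a) (s.points b - s.points a)| * ∫ x, f x ∂(faceMeasure s a) := by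
  set e := s.points b - s.points a with he
  have hD := measurableSet_closedInterior s
  have hbary := fun x t j => bary_add_smul_edge s hab x t j
  rw [← he] at hbary
  have hna := (inner_outwardNormal_edge_pos s hab).ne'
  have hnb := (inner_outwardNormal_edge_neg s hab).ne
  rw [← he] at hna hnb
  have hproj := map_oblique_projection (norm_outwardNormal s a) (norm_outwardNormal s b)
    (s.points b) (s.points a) e hna hnb
  have hπ : (fun x : E d => x - (inner ℝ (outwardNormal s a) (x - s.points b) /
      inner ℝ (outwardNormal s a) e) • e) = fun x => x + bary s a x • e := by
    funext x
    have h1 := bary_add s a (s.points b) (x - s.points b)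
    rw [bary_point_ne s hab.symm, zero_add, add_sub_cancel] at h1
    have h2 := (s.height_pos a).ne'
    have h3 : inner ℝ (outwardNormal s a) (x - s.points b) /
      inner ℝ (outwardNormal s a) e = -bary s a x := by
      rw [he, inner_outwardNormal_sub s hab, inner_outwardNormal_eq, h1]
      field_simp
    rw [h3, neg_smul, sub_neg_eq_add]
  rw [hπ] at hproj
  have hmeas : Measurable (fun x : E d => x + bary s a x • e) := by fun_prop
  have hint := congrArg (fun μ => ∫ x, s.closedInterior.indicator f x ∂μ) hproj
  simp only [integral_smul_measure, smul_eq_mul, ENNReal.toReal_ofReal (abs_nonneg _)] at hint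
  rw [integral_map hmeas.aemeasurable ((aestronglyMeasurable_indicator_iff hD).2
      (hf.aestronglyMeasurable hD)), integral_indicator hD] at hint
  rw [faceMeasure_eq s hab, faceMeasure_eq s hab.symm, ← hint, ← integral_indicator hD]
  congr 1
  refine integral_congr_ae ?_
  filter_upwards [ae_hyperplaneMeasure (outwardNormal s b) (s.points a)] with x hx
  have hxb := (inner_outwardNormal_sub_eq_zero_iff s hab).1 hx
  have hiff : x + bary s a x • e ∈ s.closedInterior ↔ x ∈ s.closedInterior := by
    have key : ∀ j, bary s j (x + bary s a x • e) =
        if j = a then 0 else if j = b then bary s a x else bary s j x := by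
      intro j
      rw [hbary, sub_self, hxb, zero_add]
    rw [mem_closedInterior_iff, mem_closedInterior_iff]
    constructor
    · intro h j
      by_cases h1 : j = a
      · have := h b; rw [key, if_neg hab.symm, if_pos rfl] at this; rwa [h1]
      · by_cases h2 : j = b
        · rw [h2, hxb]
        · have := h j; rwa [key, if_neg h1, if_neg h2] at this
    · intro h j
      rw [key]
      split_ifs
      · exact le_rfl
      · exact h a
      · exact h j
  by_cases hxD : x ∈ s.closedInterior
  · rw [Set.indicator_of_mem hxD, Set.indicator_of_mem (hiff.2 hxD)]
  · rw [Set.indicator_of_notMem hxD, Set.indicator_of_notMem (mt hiff.1 hxD)]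

/-- The divergence theorem on a simplex in the direction of the edge from `a` to `b`: integrate
along the lines parallel to that edge. -/
lemma integral_fderiv_edge {a b : Fin (d + 1)} (hab : a ≠ b) {f : E d → ℝ}
    {f' : E d → E d →L[ℝ] ℝ} (hf : ∀ x ∈ s.closedInterior, HasFDerivAt f (f' x) x)
    (hf' : ContinuousOn f' s.closedInterior) :
    ∫ x in s.closedInterior, f' x (s.points b - s.points a) =
      inner ℝ (outwardNormal s a) (s.points b - s.points a) * ∫ x, f x ∂(faceMeasure s a) +
      inner ℝ (outwardNormal s b) (s.points b - s.points a) * ∫ x, f x ∂(faceMeasure s b) := by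
  have hslide := integral_slide s hab
    (f := f) (fun x hx => (hf x hx).continuousAt.continuousWithinAt)
  set e := s.points b - s.points a with he
  have hD := measurableSet_closedInterior s
  have hfc : ContinuousOn f s.closedInterior :=
    fun x hx => (hf x hx).continuousAt.continuousWithinAt
  have hbary := fun x t j => bary_add_smul_edge s hab x t j
  rw [← he] at hbary
  have hna := inner_outwardNormal_edge_pos s hab
  have hnb := inner_outwardNormal_edge_neg s hab
  rw [← he] at hna hnb
  have hf'e : ContinuousOn (fun x => f' x e) s.closedInterior := hf'.clm_apply continuousOn_const
  have hGi : Integrable (s.closedInterior.indicator fun x => f' x e) :=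
    (integrableOn_closedInterior s hf'e).integrable_indicator hD
  have hsweep := integral_sweep (norm_outwardNormal s b) (s.points a) e hnb.ne hGi
  rw [integral_indicator hD] at hsweep
  have hline : ∀ x, bary s b x = 0 →
      ∫ t : ℝ, s.closedInterior.indicator (fun x => f' x e) (x + t • e) =
      s.closedInterior.indicator (fun x => f (x + bary s a x • e) - f x) x := by
    intro x hxb
    have key : ∀ (t : ℝ) j, bary s j (x + t • e) =
        if j = a then bary s a x - t else if j = b then t else bary s j x := by
      intro t j
      rw [hbary, hxb, zero_add]
    by_cases hx : x ∈ s.closedInterior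
    · rw [Set.indicator_of_mem hx]
      rw [mem_closedInterior_iff] at hx
      have hmem : ∀ t : ℝ, x + t • e ∈ s.closedInterior ↔ t ∈ Set.Icc 0 (bary s a x) := by
        intro t
        rw [mem_closedInterior_iff]
        constructor
        · intro h
          have h1 := h a
          have h2 := h b
          rw [key, if_pos rfl] at h1
          rw [key, if_neg hab.symm, if_pos rfl] at h2
          exact ⟨h2, by linarith⟩
        · rintro ⟨h1, h2⟩ j
          rw [key]
          split_ifs
          · linarith
          · exact h1
          · exact hx j
      have h1 : (fun t : ℝ => s.closedInterior.indicator (fun x => f' x e) (x + t • e)) =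
          (Set.Icc 0 (bary s a x)).indicator (fun t => f' (x + t • e) e) := by
        funext t
        by_cases ht : t ∈ Set.Icc 0 (bary s a x)
        · rw [Set.indicator_of_mem ht, Set.indicator_of_mem ((hmem t).2 ht)]
        · rw [Set.indicator_of_notMem ht, Set.indicator_of_notMem (mt (hmem t).1 ht)]
      rw [h1, integral_indicator measurableSet_Icc, integral_Icc_eq_integral_Ioc,
        ← intervalIntegral.integral_of_le (hx a)]
      have hd : ∀ t ∈ Set.uIcc 0 (bary s a x),
          HasDerivAt (fun t : ℝ => f (x + t • e)) (f' (x + t • e) e) t := by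
        intro t ht
        rw [Set.uIcc_of_le (hx a)] at ht
        have hl : HasDerivAt (fun t : ℝ => x + t • e) e t := by
          simpa using ((hasDerivAt_id t).smul_const e).const_add x
        exact (hf _ ((hmem t).2 ht)).comp_hasDerivAt t hl
      have hcont : ContinuousOn (fun t : ℝ => f' (x + t • e) e) (Set.uIcc 0 (bary s a x)) := by
        rw [Set.uIcc_of_le (hx a)]
        exact hf'e.comp (by fun_prop) fun t ht => (hmem t).2 ht
      rw [intervalIntegral.integral_eq_sub_of_hasDerivAt hd hcont.intervalIntegrable]
      simp
    · rw [Set.indicator_of_notMem hx]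
      have : ∀ t : ℝ, x + t • e ∉ s.closedInterior := by
        intro t ht
        apply hx
        rw [mem_closedInterior_iff] at ht ⊢
        have h1 := ht a
        have h2 := ht b
        rw [key, if_pos rfl] at h1
        rw [key, if_neg hab.symm, if_pos rfl] at h2
        intro j
        by_cases hja : j = a
        · rw [hja]; linarith
        · by_cases hjb : j = b
          · rw [hjb, hxb]
          · have := ht j; rwa [key, if_neg hja, if_neg hjb] at this
      simp [this]
  have hmapsto : ∀ x ∈ s.closedInterior, bary s b x = 0 →
      x + bary s a x • e ∈ s.closedInterior := by
    intro x hx hxb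
    rw [mem_closedInterior_iff] at hx ⊢
    intro j
    rw [hbary, sub_self, hxb, zero_add]
    split_ifs
    · exact le_rfl
    · exact hx a
    · exact hx j
  have hface : ∫ y, (∫ t : ℝ, s.closedInterior.indicator (fun x => f' x e) (y + t • e))
        ∂(hyperplaneMeasure (outwardNormal s b) (s.points a)) =
      ∫ x, (f (x + bary s a x • e) - f x) ∂(faceMeasure s b) := by
    rw [faceMeasure_eq s hab, ← integral_indicator hD]
    refine integral_congr_ae ?_
    filter_upwards [ae_hyperplaneMeasure (outwardNormal s b) (s.points a)] with x hx
    exact hline x ((inner_outwardNormal_sub_eq_zero_iff s hab).1 hx)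
  have hint : Integrable (fun x => f (x + bary s a x • e)) (faceMeasure s b) := by
    have hcl : IsClosed (s.closedInterior ∩ {x | bary s b x = 0}) :=
      s.isClosed_closedInterior.inter (isClosed_eq (by fun_prop) continuous_const)
    have hc : ContinuousOn (fun x => f (x + bary s a x • e))
        (s.closedInterior ∩ {x | bary s b x = 0}) :=
      hfc.comp (by fun_prop) fun x hx => hmapsto x hx.1 hx.2
    have hset : (s.faceOpposite b).closedInterior = s.closedInterior ∩ {x | bary s b x = 0} := by
      ext x; exact mem_faceOpposite_iff s
    have hi : IntegrableOn (fun x => f (x + bary s a x • e))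
        (s.closedInterior ∩ {x | bary s b x = 0})
        (hyperplaneMeasure (outwardNormal s b) (s.points a)) :=
      hc.integrableOn_compact (s.isCompact_closedInterior.inter_right
        (isClosed_eq (by fun_prop) continuous_const))
    have heq : faceMeasure s b = (faceMeasure s b).restrict
        (s.closedInterior ∩ {x | bary s b x = 0}) := by
      rw [faceMeasure, ← hset, Measure.restrict_restrict
        (s.faceOpposite b).isClosed_closedInterior.measurableSet, Set.inter_self]
    rw [heq, faceMeasure_eq s hab]
    exact hi.mono_measure Measure.restrict_le_self
  rw [hsweep, hface, integral_sub hint (integrable_faceMeasure s hfc b), mul_sub, hslide,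
    abs_of_pos hna, abs_of_neg hnb]
  ring

/-- The divergence theorem on a simplex, in an arbitrary fixed direction `w`. -/
theorem integral_fderiv_eq_sum_faces {f : E d → ℝ} {f' : E d → E d →L[ℝ] ℝ}
    (hf : ∀ x ∈ s.closedInterior, HasFDerivAt f (f' x) x)
    (hf' : ContinuousOn f' s.closedInterior) (w : E d) :
    ∫ x in s.closedInterior, f' x w =
      ∑ j, inner ℝ (outwardNormal s j) w * ∫ x, f x ∂(faceMeasure s j) := by
  have hedge : ∀ k, ∫ x in s.closedInterior, f' x (s.points k - s.points 0) =
      ∑ j, inner ℝ (outwardNormal s j) (s.points k - s.points 0) *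
        ∫ x, f x ∂(faceMeasure s j) := by
    intro k
    by_cases hk : k = 0
    · simp [hk]
    · rw [integral_fderiv_edge s (Ne.symm hk) hf hf',
        ← Finset.sum_subset (Finset.subset_univ {0, k}), Finset.sum_pair (Ne.symm hk)]
      intro j _ hj
      simp only [Finset.mem_insert, Finset.mem_singleton, not_or] at hj
      rw [inner_outwardNormal_eq, linear_bary_sub, bary_point_ne s (Ne.symm hj.1),
        bary_point_ne s (Ne.symm hj.2)]
      simp
  have hw := sum_linear_bary_smul s 0 w
  conv_lhs => rw [← hw]
  conv_rhs => rw [← hw]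
  simp only [map_sum, map_smul, smul_eq_mul, inner_sum, real_inner_smul_right]
  rw [integral_finsetSum]
  · simp_rw [integral_const_mul, hedge, Finset.mul_sum, Finset.sum_mul]
    rw [Finset.sum_comm]
    simp_rw [mul_assoc]
  · intro k _
    exact (integrableOn_closedInterior s (hf'.clm_apply continuousOn_const)).const_mul _

end Divergence

/-! ### Entropy variables and potentials -/

namespace EntropySystem

variable {d n : ℕ} (L : EntropySystem d n)

lemma contDiffAt_entropyVar {u : E n} (hu : u ∈ L.states) : ContDiffAt ℝ 1 L.entropyVar u := by
  have h := (L.contDiff_entropy.contDiffAt (L.isOpen_states.mem_nhds hu)).fderiv_right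
    (m := 1) (by norm_num)
  exact ((InnerProductSpace.toDual ℝ (E n)).symm.contDiff.contDiffAt).comp u h

lemma continuousOn_entropyVar : ContinuousOn L.entropyVar L.states :=
  fun _ hu => (L.contDiffAt_entropyVar hu).continuousAt.continuousWithinAt

lemma hasFDerivAt_entropyVar {u : E n} (hu : u ∈ L.states) :
    HasFDerivAt L.entropyVar (fderiv ℝ L.entropyVar u) u :=
  ((L.contDiffAt_entropyVar hu).differentiableAt (by norm_num)).hasFDerivAt

lemma inner_fderiv_entropyVar_pos {u : E n} (hu : u ∈ L.states) {w : E n} (hw : w ≠ 0) :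
    0 < inner ℝ w (fderiv ℝ L.entropyVar u w) := L.hessian_pos u hu w hw

/-- The entropy variables determine the state: the gradient of a function with positive definite
Hessian is strictly monotone along segments. -/
lemma injOn_entropyVar : Set.InjOn L.entropyVar L.states := by
  intro u hu u' hu' heq
  by_contra hne
  have hw : u' - u ≠ 0 := sub_ne_zero.2 (Ne.symm hne)
  have hmem : ∀ t ∈ Set.Icc (0 : ℝ) 1, u + t • (u' - u) ∈ L.states := by
    intro t ht
    exact L.convex_states.add_smul_sub_mem hu hu' ht
  have hd : ∀ t ∈ Set.Icc (0 : ℝ) 1,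
      HasDerivAt (fun t : ℝ => inner ℝ (u' - u) (L.entropyVar (u + t • (u' - u))))
        (inner ℝ (u' - u) (fderiv ℝ L.entropyVar (u + t • (u' - u)) (u' - u))) t := by
    intro t ht
    have hl : HasDerivAt (fun t : ℝ => u + t • (u' - u)) (u' - u) t := by
      simpa using ((hasDerivAt_id t).smul_const (u' - u)).const_add u
    have h1 := (L.hasFDerivAt_entropyVar (hmem t ht)).comp_hasDerivAt t hl
    exact ((innerSL ℝ (u' - u)).hasFDerivAt (x := L.entropyVar (u + t • (u' - u)))).comp_hasDerivAt
      t h1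
  have hmono : StrictMonoOn
      (fun t : ℝ => inner ℝ (u' - u) (L.entropyVar (u + t • (u' - u)))) (Set.Icc 0 1) := by
    refine strictMonoOn_of_deriv_pos (convex_Icc 0 1)
      (fun t ht => (hd t ht).continuousAt.continuousWithinAt) fun t ht => ?_
    rw [interior_Icc] at ht
    rw [(hd t (Set.Ioo_subset_Icc_self ht)).deriv]
    exact L.inner_fderiv_entropyVar_pos (hmem t (Set.Ioo_subset_Icc_self ht)) hw
  have := hmono (Set.left_mem_Icc.2 zero_le_one) (Set.right_mem_Icc.2 zero_le_one) zero_lt_one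
  simp [heq] at this

lemma conservativeVar_mem {w : E n} (hw : w ∈ L.entropyStates) :
    L.conservativeVar w ∈ L.states := Function.invFunOn_mem hw

lemma entropyVar_conservativeVar {w : E n} (hw : w ∈ L.entropyStates) :
    L.entropyVar (L.conservativeVar w) = w := Function.invFunOn_eq hw

lemma conservativeVar_entropyVar {u : E n} (hu : u ∈ L.states) :
    L.conservativeVar (L.entropyVar u) = u :=
  L.injOn_entropyVar (L.conservativeVar_mem ⟨u, hu, rfl⟩) hu
    (L.entropyVar_conservativeVar ⟨u, hu, rfl⟩)

/-- The inverse function theorem for the entropy variables. -/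
lemma exists_hasFDerivAt_conservativeVar {w : E n} (hw : w ∈ L.entropyStates) :
    w ∈ interior L.entropyStates ∧ ∃ A : E n →L[ℝ] E n, HasFDerivAt L.conservativeVar A w := by
  set u := L.conservativeVar w with hu_def
  have hu : u ∈ L.states := L.conservativeVar_mem hw
  have huw : L.entropyVar u = w := L.entropyVar_conservativeVar hw
  have hinj : Function.Injective (fderiv ℝ L.entropyVar u) := by
    refine (injective_iff_map_eq_zero _).2 fun z hz => ?_
    by_contra hne
    have := L.inner_fderiv_entropyVar_pos hu hne
    simp [hz] at this
  let A : E n ≃L[ℝ] E n :=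
    (LinearEquiv.ofInjectiveEndo (fderiv ℝ L.entropyVar u : E n →ₗ[ℝ] E n)
      hinj).toContinuousLinearEquiv
  have hA : (A : E n →L[ℝ] E n) = fderiv ℝ L.entropyVar u := by
    ext z : 1
    rfl
  have hs : HasStrictFDerivAt L.entropyVar (A : E n →L[ℝ] E n) u := by
    rw [hA]
    exact (L.contDiffAt_entropyVar hu).hasStrictFDerivAt (by norm_num)
  have hg := hs.to_localInverse
  have hst : ∀ᶠ z in nhds w, hs.localInverse L.entropyVar A u z ∈ L.states := by
    have hc := hg.continuousAt
    rw [huw] at hc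
    have : hs.localInverse L.entropyVar A u w = u := by rw [← huw]; exact hs.localInverse_apply_image
    rw [ContinuousAt, this] at hc
    exact hc (L.isOpen_states.mem_nhds hu)
  have hright : ∀ᶠ z in nhds w, L.entropyVar (hs.localInverse L.entropyVar A u z) = z := by
    rw [← huw]; exact hs.eventually_right_inverse
  have hev : ∀ᶠ z in nhds w, z ∈ L.entropyStates := by
    filter_upwards [hst, hright] with z h1 h2
    exact ⟨_, h1, h2⟩
  refine ⟨mem_interior_iff_mem_nhds.2 hev, (A.symm : E n →L[ℝ] E n), ?_⟩
  have hg' := hg.hasFDerivAt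
  rw [huw] at hg'
  refine hg'.congr_of_eventuallyEq ?_
  filter_upwards [hst, hright] with z h1 h2
  conv_lhs => rw [← h2]
  exact L.conservativeVar_entropyVar h1

lemma differentiableAt_conservativeVar {w : E n} (hw : w ∈ L.entropyStates) :
    DifferentiableAt ℝ L.conservativeVar w :=
  (L.exists_hasFDerivAt_conservativeVar hw).2.elim fun _ h => h.differentiableAt

lemma differentiableAt_flux (m : Fin d) {u : E n} (hu : u ∈ L.states) :
    DifferentiableAt ℝ (L.flux m) u :=
  (L.differentiable_flux m).differentiableAt (L.isOpen_states.mem_nhds hu)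

lemma differentiableAt_flux_conservativeVar (m : Fin d) {w : E n} (hw : w ∈ L.entropyStates) :
    DifferentiableAt ℝ (fun z => L.flux m (L.conservativeVar z)) w :=
  DifferentiableAt.comp w (L.differentiableAt_flux m (L.conservativeVar_mem hw))
    (L.differentiableAt_conservativeVar hw)

/-- The flux is the gradient of the entropy potential with respect to the entropy variables. -/
lemma hasFDerivAt_potential (m : Fin d) {w : E n} (hw : w ∈ L.entropyStates) :
    HasFDerivAt (fun z => L.potential m (L.conservativeVar z))
      (innerSL ℝ (L.flux m (L.conservativeVar w))) w := by
  obtain ⟨hint, A, hA⟩ := L.exists_hasFDerivAt_conservativeVar hw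
  set u := L.conservativeVar w with hu_def
  have hu : u ∈ L.states := L.conservativeVar_mem hw
  have hf := (L.differentiableAt_flux m hu).hasFDerivAt.comp w hA
  have hF := (((L.differentiable_entropyFlux m).differentiableAt
    (L.isOpen_states.mem_nhds hu)).hasFDerivAt).comp w hA
  have h := ((hasFDerivAt_id w).inner ℝ hf).sub hF
  have h' : HasFDerivAt (fun z => inner ℝ z (L.flux m (L.conservativeVar z)) -
      L.entropyFlux m (L.conservativeVar z)) (innerSL ℝ (L.flux m u)) w := by
    refine h.congr_fderiv ?_
    ext z
    have hc := L.compatibility m u hu (A z)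
    have huw : gradient L.entropy u = w := L.entropyVar_conservativeVar hw
    rw [huw] at hc
    simp [fderivInnerCLM_apply, hc, real_inner_comm, ← hu_def]
  refine h'.congr_of_eventuallyEq ?_
  filter_upwards [mem_interior_iff_mem_nhds.1 hint] with z hz
  rw [potential, L.entropyVar_conservativeVar hz]

end EntropySystem

/-! ### Polynomials of bounded degree -/

section Polynomials

variable {d : ℕ}

namespace IsPoly

lemma mono {M N : ℕ} (h : M ≤ N) {f : E d → ℝ} (hf : IsPoly M f) : IsPoly N f :=
  hf.imp fun _ hp => ⟨hp.1.trans h, hp.2⟩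

lemma const (N : ℕ) (c : ℝ) : IsPoly N (fun _ : E d => c) :=
  ⟨MvPolynomial.C c, by simp, by simp⟩

lemma coord (i : Fin d) : IsPoly 1 (fun x : E d => x i) :=
  ⟨MvPolynomial.X i, by simp, by simp⟩

lemma add {N : ℕ} {f g : E d → ℝ} (hf : IsPoly N f) (hg : IsPoly N g) :
    IsPoly N (fun x => f x + g x) := by
  obtain ⟨p, hp, hpf⟩ := hf
  obtain ⟨q, hq, hqg⟩ := hg
  exact ⟨p + q, (MvPolynomial.totalDegree_add p q).trans (max_le hp hq), fun x => by
    simp [hpf, hqg]⟩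

lemma mul {M N : ℕ} {f g : E d → ℝ} (hf : IsPoly M f) (hg : IsPoly N g) :
    IsPoly (M + N) (fun x => f x * g x) := by
  obtain ⟨p, hp, hpf⟩ := hf
  obtain ⟨q, hq, hqg⟩ := hg
  exact ⟨p * q, (MvPolynomial.totalDegree_mul p q).trans (add_le_add hp hq), fun x => by
    simp [hpf, hqg]⟩

lemma const_mul {N : ℕ} (c : ℝ) {f : E d → ℝ} (hf : IsPoly N f) : IsPoly N (fun x => c * f x) := by
  simpa using (const 0 c).mul hf

lemma sub {N : ℕ} {f g : E d → ℝ} (hf : IsPoly N f) (hg : IsPoly N g) :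
    IsPoly N (fun x => f x - g x) := by
  simpa [sub_eq_add_neg] using hf.add (hg.const_mul (-1))

lemma sum {N : ℕ} {ι : Type*} (t : Finset ι) {f : ι → E d → ℝ} (hf : ∀ i ∈ t, IsPoly N (f i)) :
    IsPoly N (fun x => ∑ i ∈ t, f i x) := by
  classical
  induction t using Finset.induction_on with
  | empty => simpa using const N 0
  | insert a t ha ih =>
    simp only [Finset.sum_insert ha]
    exact (hf a (Finset.mem_insert_self a t)).add
      (ih fun i hi => hf i (Finset.mem_insert_of_mem hi))

lemma prod {ι : Type*} (t : Finset ι) {N : ι → ℕ} {f : ι → E d → ℝ}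
    (hf : ∀ i ∈ t, IsPoly (N i) (f i)) : IsPoly (∑ i ∈ t, N i) (fun x => ∏ i ∈ t, f i x) := by
  classical
  induction t using Finset.induction_on with
  | empty => simpa using const 0 1
  | insert a t ha ih =>
    simp only [Finset.sum_insert ha, Finset.prod_insert ha]
    exact (hf a (Finset.mem_insert_self a t)).mul
      (ih fun i hi => hf i (Finset.mem_insert_of_mem hi))

lemma pow {M : ℕ} {f : E d → ℝ} (hf : IsPoly M f) (k : ℕ) : IsPoly (k * M) (fun x => f x ^ k) := by
  simpa using prod (Finset.range k) (N := fun _ => M) (f := fun _ => f) fun _ _ => hf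

/-- Substituting polynomials of degree one does not raise the degree. -/
lemma comp {d' N : ℕ} {f : E d → ℝ} (hf : IsPoly N f) {A : E d' → E d}
    (hA : ∀ i, IsPoly 1 (fun t => A t i)) : IsPoly N (fun t => f (A t)) := by
  obtain ⟨p, hp, hpf⟩ := hf
  simp only [hpf, MvPolynomial.eval_eq]
  refine sum _ fun m hm => const_mul _ ?_
  refine (prod m.support (N := fun i => m i * 1) fun i _ => (hA i).pow (m i)).mono ?_
  simp only [mul_one]
  exact (MvPolynomial.le_totalDegree hm).trans hp

lemma affine (ℓ : E d →ᵃ[ℝ] ℝ) : IsPoly 1 ℓ := by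
  have h : ∀ x, ℓ x = ℓ 0 + ∑ i, ℓ.linear (EuclideanSpace.single i 1) * x i := by
    intro x
    have h1 := ℓ.map_vadd 0 x
    rw [vadd_eq_add, vadd_eq_add, add_zero] at h1
    rw [h1, add_comm]
    congr 1
    conv_lhs => rw [← (EuclideanSpace.basisFun (Fin d) ℝ).sum_repr x]
    simp [mul_comm]
  rw [show (ℓ : E d → ℝ) = _ from funext h]
  exact (const 1 _).add (sum _ fun i _ => (coord i).const_mul _)

lemma hasFDerivAt_eval (p : MvPolynomial (Fin d) ℝ) (x : E d) :
    HasFDerivAt (fun x : E d => MvPolynomial.eval (fun i => x i) p)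
      (∑ i, MvPolynomial.eval (fun i => x i) (MvPolynomial.pderiv i p) •
        (EuclideanSpace.proj i : E d →L[ℝ] ℝ)) x := by
  induction p using MvPolynomial.induction_on with
  | C a => simpa using hasFDerivAt_const a x
  | add p q hp hq =>
    simp only [map_add, add_smul, Finset.sum_add_distrib]
    exact hp.add hq
  | mul_X p i hp =>
    have hi : HasFDerivAt (fun x : E d => x i) (EuclideanSpace.proj i : E d →L[ℝ] ℝ) x :=
      (EuclideanSpace.proj i : E d →L[ℝ] ℝ).hasFDerivAt
    have h := hp.mul hi
    simp only [map_mul, MvPolynomial.eval_X]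
    refine h.congr_fderiv ?_
    ext w
    simp only [add_apply, smul_apply, smul_eq_mul,
      sum_apply, PiLp.proj_apply, Derivation.leibniz, map_add,
      MvPolynomial.pderiv_X, map_mul, MvPolynomial.eval_X, add_mul, Finset.sum_add_distrib]
    congr 1
    · rw [Finset.sum_eq_single i]
      · simp
      · intro j _ hj
        simp [hj.symm]
      · simp
    · rw [Finset.mul_sum]
      exact Finset.sum_congr rfl fun j _ => by ring

lemma totalDegree_pderiv_le (p : MvPolynomial (Fin d) ℝ) (i : Fin d) :
    (MvPolynomial.pderiv i p).totalDegree ≤ p.totalDegree - 1 := by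
  conv_lhs => rw [p.as_sum, map_sum]
  refine MvPolynomial.totalDegree_finsetSum_le fun m hm => ?_
  rw [MvPolynomial.pderiv_monomial]
  by_cases hmi : m i = 0
  · simp [hmi]
  refine (MvPolynomial.totalDegree_monomial_le _ _).trans ?_
  have h1 := MvPolynomial.le_totalDegree hm
  have h2 : (m - Finsupp.single i 1).sum (fun _ => id) + 1 = m.sum (fun _ e => e) := by
    have h3 : m = (m - Finsupp.single i 1) + Finsupp.single i 1 := by
      rw [tsub_add_cancel_of_le]
      simpa using Nat.one_le_iff_ne_zero.2 hmi
    conv_rhs => rw [h3]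
    rw [Finsupp.sum_add_index' (by simp) (by simp)]
    simp [Finsupp.sum]
  omega

variable {N : ℕ} {f : E d → ℝ}

lemma contDiff (hf : IsPoly N f) : ContDiff ℝ 1 f := by
  obtain ⟨p, -, hpf⟩ := hf
  rw [funext hpf]
  simp only [MvPolynomial.eval_eq]
  fun_prop

lemma continuous (hf : IsPoly N f) : Continuous f := hf.contDiff.continuous

lemma differentiable (hf : IsPoly N f) : Differentiable ℝ f :=
  hf.contDiff.differentiable (by norm_num)

lemma continuous_fderiv (hf : IsPoly N f) : Continuous (fderiv ℝ f) :=
  hf.contDiff.continuous_fderiv (by norm_num)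

lemma analyticOnNhd (hf : IsPoly N f) : AnalyticOnNhd ℝ f Set.univ := by
  obtain ⟨p, -, hpf⟩ := hf
  rw [funext hpf]
  refine AnalyticOnNhd.aeval_mvPolynomial (f := fun (x : E d) i => x i) (fun i => ?_) p
  exact (EuclideanSpace.proj i : E d →L[ℝ] ℝ).analyticOnNhd _

lemma fderiv_mul (hf : IsPoly N f) (ℓ : E d → ℝ) (hℓ : IsPoly 1 ℓ) (w : E d) :
    IsPoly N (fun x => ℓ x * fderiv ℝ f x w) := by
  obtain ⟨p, hp, hpf⟩ := hf
  have hd : ∀ x, fderiv ℝ f x w =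
      ∑ i, w i * MvPolynomial.eval (fun i => x i) (MvPolynomial.pderiv i p) := by
    intro x
    rw [funext hpf, (hasFDerivAt_eval p x).fderiv]
    simp [mul_comm]
  simp only [hd]
  rcases Nat.eq_zero_or_pos p.totalDegree with h0 | h0
  · rw [MvPolynomial.totalDegree_eq_zero_iff_eq_C.1 h0]
    simpa using const N 0
  · refine (hℓ.mul (N := p.totalDegree - 1) (sum _ fun i _ => const_mul _ ?_)).mono (by omega)
    exact ⟨_, totalDegree_pderiv_le p i, fun _ => rfl⟩

end IsPoly

/-- The space `P^N` as a space of functions. -/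
def polySpace (d N : ℕ) : Submodule ℝ (E d → ℝ) where
  carrier := {f | IsPoly N f}
  add_mem' := fun hf hg => hf.add hg
  zero_mem' := IsPoly.const N 0
  smul_mem' := fun c _ hf => hf.const_mul c

instance (d N : ℕ) : FiniteDimensional ℝ (polySpace d N) := by
  let ev : MvPolynomial (Fin d) ℝ →ₗ[ℝ] (E d → ℝ) :=
    { toFun := fun p x => MvPolynomial.eval (fun i => x i) p
      map_add' := fun p q => by ext; simp
      map_smul' := fun c p => by ext; simp }
  have h : polySpace d N = (MvPolynomial.restrictTotalDegree (Fin d) ℝ N).map ev := by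
    ext f
    simp only [Submodule.mem_map, MvPolynomial.mem_restrictTotalDegree]
    constructor
    · rintro ⟨p, hp, hpf⟩
      exact ⟨p, hp, (funext hpf).symm⟩
    · rintro ⟨p, hp, rfl⟩
      exact ⟨p, hp, fun _ => rfl⟩
  rw [h]
  infer_instance

end Polynomials

/-! ### Quadratic expressions on finite-dimensional spaces -/

section FiniteDimensional

lemma exists_bound_of_ker_le {V F G : Type*} [AddCommGroup V] [Module ℝ V] [FiniteDimensional ℝ V]
    [NormedAddCommGroup F] [NormedSpace ℝ F] [NormedAddCommGroup G] [NormedSpace ℝ G]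
    (S : V →ₗ[ℝ] F) (T : V →ₗ[ℝ] G) (h : S.ker ≤ T.ker) :
    ∃ C : ℝ, 0 < C ∧ ∀ v, ‖T v‖ ≤ C * ‖S v‖ := by
  obtain ⟨R, hR⟩ := S.rangeRestrict.exists_rightInverse_of_surjective S.range_rangeRestrict
  let M : S.range →L[ℝ] G := (T ∘ₗ R).toContinuousLinearMap
  refine ⟨‖M‖ + 1, by positivity, fun v => ?_⟩
  have hv : T v = M (S.rangeRestrict v) := by
    have h1 : S.rangeRestrict (R (S.rangeRestrict v)) = S.rangeRestrict v := LinearMap.congr_fun hR _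
    have h2 : v - R (S.rangeRestrict v) ∈ T.ker := h (by
      rw [LinearMap.mem_ker, map_sub, sub_eq_zero]
      exact (congrArg Subtype.val h1).symm)
    rw [LinearMap.mem_ker, map_sub, sub_eq_zero] at h2
    exact h2
  rw [hv]
  refine (M.le_opNorm _).trans ?_
  have : ‖S.rangeRestrict v‖ = ‖S v‖ := rfl
  rw [this]
  have := norm_nonneg (S v)
  nlinarith

/-- A linear family of square integrable functions, as a linear map into `L²`. -/
def toL2 {V X : Type*} [AddCommGroup V] [Module ℝ V] [MeasurableSpace X] (μ : Measure X)
    (Φ : V →ₗ[ℝ] (X → ℝ)) (hΦ : ∀ v, MemLp (Φ v) 2 μ) : V →ₗ[ℝ] Lp ℝ 2 μ where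
  toFun v := (hΦ v).toLp (Φ v)
  map_add' v w := by
    rw [← MemLp.toLp_add (hΦ v) (hΦ w)]
    congr 1
    exact map_add Φ v w
  map_smul' c v := by
    rw [RingHom.id_apply, ← MemLp.toLp_const_smul c (hΦ v)]
    congr 1
    exact map_smul Φ c v

lemma norm_sq_toL2 {V X : Type*} [AddCommGroup V] [Module ℝ V] [MeasurableSpace X] (μ : Measure X)
    (Φ : V →ₗ[ℝ] (X → ℝ)) (hΦ : ∀ v, MemLp (Φ v) 2 μ) (v : V) :
    ‖toL2 μ Φ hΦ v‖ ^ 2 = ∫ x, Φ v x ^ 2 ∂μ := by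
  rw [← real_inner_self_eq_norm_sq, L2.inner_def]
  refine integral_congr_ae ?_
  filter_upwards [(hΦ v).coeFn_toLp] with x hx
  have : (toL2 μ Φ hΦ v) x = Φ v x := hx
  rw [this]
  simp [sq]

/-- On a finite-dimensional space, one quadratic `L²` expression is dominated by another as soon as
it vanishes wherever the other one does. -/
lemma exists_integral_sq_le {V X ι : Type*} [AddCommGroup V] [Module ℝ V] [FiniteDimensional ℝ V]
    [Fintype ι] [MeasurableSpace X] (μ : Measure X) (Φ : ι → V →ₗ[ℝ] (X → ℝ))
    (Ψ : V →ₗ[ℝ] (X → ℝ)) (hΦ : ∀ i v, MemLp (Φ i v) 2 μ) (hΨ : ∀ v, MemLp (Ψ v) 2 μ)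
    (hker : ∀ v, (∀ i, Φ i v =ᵐ[μ] 0) → Ψ v =ᵐ[μ] 0) :
    ∃ C : ℝ, 0 < C ∧ ∀ v, ∫ x, Ψ v x ^ 2 ∂μ ≤ C * ∑ i, ∫ x, Φ i v x ^ 2 ∂μ := by
  obtain ⟨C, hC, hb⟩ := exists_bound_of_ker_le (LinearMap.pi fun i => toL2 μ (Φ i) (hΦ i))
    (toL2 μ Ψ hΨ) (by
      intro v hv
      rw [LinearMap.mem_ker] at hv ⊢
      refine ((hΨ v).toLp_eq_toLp_iff MemLp.zero).2 (hker v fun i => ?_) |>.trans ?_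
      · have : (hΦ i v).toLp (Φ i v) = (MemLp.zero (ε := ℝ) (p := 2) (μ := μ)).toLp 0 := congrFun hv i
        exact ((hΦ i v).toLp_eq_toLp_iff MemLp.zero).1 this
      · exact MemLp.toLp_zero _)
  refine ⟨C ^ 2, by positivity, fun v => ?_⟩
  have h1 : ‖toL2 μ Ψ hΨ v‖ ^ 2 ≤
      C ^ 2 * ‖LinearMap.pi (fun i => toL2 μ (Φ i) (hΦ i)) v‖ ^ 2 := by
    rw [← mul_pow]
    exact pow_le_pow_left₀ (norm_nonneg _) (hb v) 2
  rw [norm_sq_toL2] at h1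
  refine h1.trans (mul_le_mul_of_nonneg_left ?_ (by positivity))
  simp_rw [← norm_sq_toL2 μ (Φ _) (hΦ _)]
  have hsum : 0 ≤ ∑ i, ‖toL2 μ (Φ i) (hΦ i) v‖ ^ 2 := Finset.sum_nonneg fun i _ => by positivity
  rw [← Real.le_sqrt (norm_nonneg _) , pi_norm_le_iff_of_nonneg (Real.sqrt_nonneg _)]
  · intro i
    refine Real.le_sqrt_of_sq_le ?_
    exact Finset.single_le_sum (f := fun i => ‖toL2 μ (Φ i) (hΦ i) v‖ ^ 2)
      (fun i _ => by positivity) (Finset.mem_univ i)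
  · exact hsum

end FiniteDimensional

/-! ### Norm equivalence on the standard simplex -/

section Reference

/-- The closed standard simplex `{t ≥ 0, ∑ t ≤ 1}`. -/
def refSimplex (d : ℕ) : Set (E d) := {t | (∀ k, 0 ≤ t k) ∧ ∑ k, t k ≤ 1}

lemma isClosed_refSimplex (d : ℕ) : IsClosed (refSimplex d) := by
  have h : refSimplex d = (⋂ k, {t : E d | 0 ≤ t k}) ∩ {t : E d | ∑ k, t k ≤ 1} := by
    ext t; simp [refSimplex]
  rw [h]
  exact (isClosed_iInter fun k => isClosed_le (by fun_prop) (by fun_prop)).inter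
    (isClosed_le (by fun_prop) (by fun_prop))

lemma isCompact_refSimplex (d : ℕ) : IsCompact (refSimplex d) := by
  refine Metric.isCompact_of_isClosed_isBounded (isClosed_refSimplex d) ?_
  refine (Metric.isBounded_closedBall (x := (0 : E d)) (r := 1)).subset fun t ht => ?_
  rw [mem_closedBall_zero_iff, ← sq_le_one_iff₀ (norm_nonneg t), EuclideanSpace.real_norm_sq_eq]
  have h1 : ∀ k, t k ≤ 1 := fun k =>
    (Finset.single_le_sum (f := fun k => t k) (fun i _ => ht.1 i) (Finset.mem_univ k)).trans ht.2
  refine (Finset.sum_le_sum fun k _ => ?_).trans ht.2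
  nlinarith [ht.1 k, h1 k]

/-- A polynomial whose gradient vanishes on a nonempty open set is constant. -/
lemma IsPoly.eq_const_of_fderiv_eq_zero {d N : ℕ} {f : E d → ℝ} (hf : IsPoly N f) {O : Set (E d)}
    (hO : IsOpen O) (hne : O.Nonempty) (h : ∀ x ∈ O, fderiv ℝ f x = 0) (x y : E d) :
    f x = f y := by
  obtain ⟨z, hz⟩ := hne
  have hev : f =ᶠ[nhds z] fun _ => f z := by
    obtain ⟨r, hr, hball⟩ := Metric.isOpen_iff.1 hO z hz
    filter_upwards [Metric.ball_mem_nhds z hr] with y hy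
    refine (convex_ball z r).is_const_of_fderivWithin_eq_zero (𝕜 := ℝ)
      hf.differentiable.differentiableOn (fun x hx => ?_) hy (Metric.mem_ball_self hr)
    rw [fderivWithin_of_isOpen Metric.isOpen_ball hx, h x (hball hx)]
  have := hf.analyticOnNhd.eq_of_eventuallyEq analyticOnNhd_const hev
  rw [this]

lemma clm_eq_zero_of_single {d : ℕ} {A : E d →L[ℝ] ℝ}
    (h : ∀ k, A (EuclideanSpace.single k 1) = 0) : A = 0 := by
  ext w
  rw [← (EuclideanSpace.basisFun (Fin d) ℝ).sum_repr w]
  simp [h]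

/-- The directional derivative on `P^N`, as a linear map. -/
def polyDeriv (d N : ℕ) (k : Fin d) : polySpace d N →ₗ[ℝ] (E d → ℝ) where
  toFun f x := fderiv ℝ f.1 x (EuclideanSpace.single k 1)
  map_add' f g := by
    ext x
    have : ((f + g : polySpace d N) : E d → ℝ) = f.1 + g.1 := rfl
    rw [this, fderiv_add (IsPoly.differentiable f.2 x) (IsPoly.differentiable g.2 x)]
    rfl
  map_smul' c f := by
    ext x
    have : ((c • f : polySpace d N) : E d → ℝ) = c • f.1 := rfl
    rw [this, fderiv_const_smul (IsPoly.differentiable f.2 x)]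
    rfl

/-- Multiplication by `√t_k` on functions. -/
def mulSqrtCoord (d : ℕ) (k : Fin d) : (E d → ℝ) →ₗ[ℝ] (E d → ℝ) where
  toFun f t := √(t k) * f t
  map_add' f g := by ext t; simp [mul_add]
  map_smul' c f := by ext t; simp [mul_left_comm]

/-- Subtraction of the value at the origin. -/
def subOrigin (d N : ℕ) : polySpace d N →ₗ[ℝ] (E d → ℝ) where
  toFun f t := f.1 t - f.1 0
  map_add' f g := by ext t; simp; ring
  map_smul' c f := by ext t; simp; ring

/-- On the standard simplex the weighted Dirichlet form `∑ ∫ t_k (∂_k p)²` vanishes only for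
constant polynomials, so on `P^N` it dominates the `L²` norms of the derivatives and of `p - p(0)`. -/
lemma exists_refSimplex_bound (d N : ℕ) : ∃ C : ℝ, 0 < C ∧ ∀ f : E d → ℝ, IsPoly N f →
    (∀ k, ∫ t in refSimplex d, fderiv ℝ f t (EuclideanSpace.single k 1) ^ 2 ≤
      C * ∑ l, ∫ t in refSimplex d, t l * fderiv ℝ f t (EuclideanSpace.single l 1) ^ 2) ∧
    ∫ t in refSimplex d, (f t - f 0) ^ 2 ≤
      C * ∑ l, ∫ t in refSimplex d, t l * fderiv ℝ f t (EuclideanSpace.single l 1) ^ 2 := by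
  have hmem : ∀ {g : E d → ℝ}, Continuous g → MemLp g 2 (volume.restrict (refSimplex d)) := by
    intro g hg
    have : IsFiniteMeasure (volume.restrict (refSimplex d)) :=
      ⟨by simpa using (isCompact_refSimplex d).measure_lt_top⟩
    obtain ⟨B, hB⟩ := (isCompact_refSimplex d).exists_bound_of_continuousOn hg.continuousOn
    refine MemLp.of_bound hg.aestronglyMeasurable B ?_
    exact (ae_restrict_iff' (isClosed_refSimplex d).measurableSet).2
      (Filter.Eventually.of_forall hB)
  have hcd : ∀ (f : polySpace d N) (k : Fin d), Continuous (polyDeriv d N k f) := fun f k =>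
    (IsPoly.continuous_fderiv f.2).clm_apply continuous_const
  let Φ : Fin d → polySpace d N →ₗ[ℝ] (E d → ℝ) := fun k => mulSqrtCoord d k ∘ₗ polyDeriv d N k
  have hΦ : ∀ k v, MemLp (Φ k v) 2 (volume.restrict (refSimplex d)) := by
    intro k v
    refine hmem ?_
    have := hcd v k
    change Continuous fun t : E d => √(t k) * polyDeriv d N k v t
    fun_prop
  have hconst : ∀ v, (∀ k, Φ k v =ᵐ[volume.restrict (refSimplex d)] 0) →
      ∀ x y, v.1 x = v.1 y := by
    intro v hv
    let O : Set (E d) := (⋂ k, {t : E d | 0 < t k}) ∩ {t : E d | ∑ k, t k < 1}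
    have hO : IsOpen O := (isOpen_iInter_of_finite fun k =>
      isOpen_lt continuous_const (by fun_prop)).inter (isOpen_lt (by fun_prop) continuous_const)
    have hOT : O ⊆ refSimplex d := fun t ht =>
      ⟨fun k => (Set.mem_iInter.1 ht.1 k).le, le_of_lt ht.2⟩
    refine IsPoly.eq_const_of_fderiv_eq_zero v.2 hO ?_ fun t ht => ?_
    · refine ⟨WithLp.toLp 2 fun _ => ((d : ℝ) + 1)⁻¹, ?_, ?_⟩
      · simp only [Set.mem_iInter, Set.mem_ofPred_eq]
        intro k; positivity
      · simp only [Set.mem_ofPred_eq, Finset.sum_const, Finset.card_univ, Fintype.card_fin,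
          nsmul_eq_mul]
        rw [← div_eq_mul_inv, div_lt_one (by positivity)]
        linarith
    · refine clm_eq_zero_of_single fun k => ?_
      have hc : Continuous (Φ k v) := by
        have := hcd v k
        change Continuous fun t : E d => √(t k) * polyDeriv d N k v t
        fun_prop
      have h0 := Measure.eqOn_open_of_ae_eq
        (ae_restrict_of_ae_restrict_of_subset hOT (hv k)) hO hc.continuousOn continuousOn_const ht
      have h1 : √(t k) ≠ 0 := (Real.sqrt_pos.2 (Set.mem_iInter.1 ht.1 k)).ne'
      exact (mul_eq_zero.1 h0).resolve_left h1
  have hsum : ∀ v, ∑ l, ∫ t in refSimplex d, Φ l v t ^ 2 =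
      ∑ l, ∫ t in refSimplex d, t l * fderiv ℝ v.1 t (EuclideanSpace.single l 1) ^ 2 := by
    intro v
    refine Finset.sum_congr rfl fun l _ => ?_
    refine setIntegral_congr_fun (isClosed_refSimplex d).measurableSet fun t ht => ?_
    change (√(t l) * fderiv ℝ v.1 t (EuclideanSpace.single l 1)) ^ 2 = _
    rw [mul_pow, Real.sq_sqrt (ht.1 l)]
  have hderiv : ∀ k, ∃ C : ℝ, 0 < C ∧ ∀ v, ∫ t in refSimplex d, polyDeriv d N k v t ^ 2 ≤
      C * ∑ l, ∫ t in refSimplex d, Φ l v t ^ 2 := by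
    intro k
    refine exists_integral_sq_le _ Φ (polyDeriv d N k) hΦ (fun v => hmem (hcd v k)) ?_
    intro v hv
    have h0 : v.1 = fun _ => v.1 0 := funext fun x => hconst v hv x 0
    refine Filter.Eventually.of_forall fun t => ?_
    change fderiv ℝ v.1 t _ = 0
    rw [h0]; simp
  obtain ⟨C₀, hC₀, hb₀⟩ := exists_integral_sq_le _ Φ (subOrigin d N) hΦ
    (fun v => hmem ((IsPoly.continuous v.2).sub continuous_const)) (by
      intro v hv
      refine Filter.Eventually.of_forall fun t => ?_
      exact sub_eq_zero.2 (hconst v hv t 0))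
  choose C hC hb using hderiv
  have hCsum : 0 ≤ ∑ k, C k := Finset.sum_nonneg fun k _ => (hC k).le
  refine ⟨C₀ + ∑ k, C k, by positivity, fun f hf => ?_⟩
  have hnn : 0 ≤ ∑ l, ∫ t in refSimplex d, Φ l ⟨f, hf⟩ t ^ 2 :=
    Finset.sum_nonneg fun l _ => integral_nonneg fun t => sq_nonneg _
  have hs := hsum ⟨f, hf⟩
  constructor
  · intro k
    rw [← hs]
    refine (hb k ⟨f, hf⟩).trans (mul_le_mul_of_nonneg_right ?_ hnn)
    have := Finset.single_le_sum (f := C) (fun k _ => (hC k).le) (Finset.mem_univ k)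
    linarith
  · rw [← hs]
    refine (hb₀ ⟨f, hf⟩).trans (mul_le_mul_of_nonneg_right ?_ hnn)
    linarith

end Reference

/-! ### Transfer to an arbitrary simplex -/

section Transfer

variable {d : ℕ} (s : Affine.Simplex ℝ (E d) d) (j₀ : Fin (d + 1))

/-- The edge from the vertex `j₀` to the `k`-th of the remaining vertices. -/
def edge (k : Fin d) : E d := s.points (j₀.succAbove k) - s.points j₀

/-- The linear part of the affine map from the standard simplex onto `s` that sends the origin to
the vertex `j₀`. -/
def refLinear : E d →L[ℝ] E d :=
  ∑ k, (EuclideanSpace.proj k : E d →L[ℝ] ℝ).smulRight (edge s j₀ k)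

lemma refLinear_apply (t : E d) : refLinear s j₀ t = ∑ k, t k • edge s j₀ k := by
  simp [refLinear]

lemma refLinear_single (k : Fin d) : refLinear s j₀ (EuclideanSpace.single k 1) = edge s j₀ k := by
  rw [refLinear_apply, Finset.sum_eq_single k] <;> simp +contextual

/-- The affine map from the standard simplex onto `s` that sends the origin to the vertex `j₀`. -/
def refMap (t : E d) : E d := s.points j₀ + refLinear s j₀ t

lemma hasFDerivAt_refMap (t : E d) : HasFDerivAt (refMap s j₀) (refLinear s j₀) t :=
  (refLinear s j₀).hasFDerivAt.const_add _

lemma linear_bary_edge (k l : Fin d) :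
    (bary s (j₀.succAbove k)).linear (edge s j₀ l) = if k = l then 1 else 0 := by
  rw [edge, linear_bary_sub, bary_point_ne s (Fin.succAbove_ne j₀ k).symm, sub_zero]
  split_ifs with h
  · rw [h, bary_point_self]
  · exact bary_point_ne s (fun h' => h (Fin.succAbove_right_injective h').symm)

lemma bary_refMap (k : Fin d) (t : E d) : bary s (j₀.succAbove k) (refMap s j₀ t) = t k := by
  rw [refMap, bary_add, bary_point_ne s (Fin.succAbove_ne j₀ k).symm, refLinear_apply,
    map_sum]
  simp [linear_bary_edge]

lemma bary_refMap_self (t : E d) : bary s j₀ (refMap s j₀ t) = 1 - ∑ k, t k := by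
  have := sum_bary s (refMap s j₀ t)
  rw [Fin.sum_univ_succAbove _ j₀] at this
  simp_rw [bary_refMap] at this
  linarith

lemma refMap_injective : Function.Injective (refMap s j₀) := by
  intro t t' h
  ext k
  rw [← bary_refMap s j₀ k t, h, bary_refMap]

lemma refMap_bary (x : E d) :
    refMap s j₀ (WithLp.toLp 2 fun k => bary s (j₀.succAbove k) x) = x := by
  have h := sum_bary_smul s x
  have h1 := sum_bary s x
  rw [Fin.sum_univ_succAbove _ j₀] at h h1
  rw [refMap, refLinear_apply]
  simp only [edge, smul_sub, Finset.sum_sub_distrib, ← Finset.sum_smul]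
  rw [← eq_sub_iff_add_eq'] at h1
  rw [h1]
  conv_rhs => rw [← h]
  module

lemma image_refMap : refMap s j₀ '' refSimplex d = s.closedInterior := by
  ext x
  rw [mem_closedInterior_iff]
  constructor
  · rintro ⟨t, ht, rfl⟩ j
    rcases Fin.eq_self_or_eq_succAbove j₀ j with rfl | ⟨k, rfl⟩
    · rw [bary_refMap_self]; linarith [ht.2]
    · rw [bary_refMap]; exact ht.1 k
  · intro hx
    refine ⟨_, ⟨fun k => hx _, ?_⟩, refMap_bary s j₀ x⟩
    have h1 := sum_bary s x
    rw [Fin.sum_univ_succAbove _ j₀] at h1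
    have := hx j₀
    simp only
    linarith

lemma setIntegral_closedInterior_eq (g : E d → ℝ) :
    ∫ x in s.closedInterior, g x =
      |(refLinear s j₀).det| * ∫ t in refSimplex d, g (refMap s j₀ t) := by
  rw [← image_refMap s j₀, integral_image_eq_integral_abs_det_fderiv_smul volume
    (isClosed_refSimplex d).measurableSet
    (fun t _ => (hasFDerivAt_refMap s j₀ t).hasFDerivWithinAt) (refMap_injective s j₀).injOn]
  simp only [smul_eq_mul, integral_const_mul]

/-- The degenerate weighted Dirichlet form of a polynomial dominates its derivatives along the
edges at the vertex `j₀` and its deviation from the value there, with a constant that does not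
depend on the simplex. -/
lemma exists_simplex_bound (d N : ℕ) : ∃ C : ℝ, 0 < C ∧
    ∀ (s : Affine.Simplex ℝ (E d) d) (j₀ : Fin (d + 1)) (f : E d → ℝ), IsPoly N f →
    (∀ k, ∫ x in s.closedInterior, fderiv ℝ f x (edge s j₀ k) ^ 2 ≤
      C * ∑ l, ∫ x in s.closedInterior,
        bary s (j₀.succAbove l) x * fderiv ℝ f x (edge s j₀ l) ^ 2) ∧
    ∫ x in s.closedInterior, (f x - f (s.points j₀)) ^ 2 ≤
      C * ∑ l, ∫ x in s.closedInterior,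
        bary s (j₀.succAbove l) x * fderiv ℝ f x (edge s j₀ l) ^ 2 := by
  obtain ⟨C, hC, hb⟩ := exists_refSimplex_bound d N
  refine ⟨C, hC, fun s j₀ f hf => ?_⟩
  have hcomp : IsPoly N (fun t => f (refMap s j₀ t)) := by
    refine hf.comp fun i => ?_
    have : ∀ t, refMap s j₀ t i = s.points j₀ i + ∑ k, edge s j₀ k i * t k := by
      intro t
      simp [refMap, refLinear_apply, mul_comm]
    simp only [this]
    exact (IsPoly.const 1 _).add (IsPoly.sum _ fun k _ => (IsPoly.coord k).const_mul _)
  have hd : ∀ t k, fderiv ℝ (fun t => f (refMap s j₀ t)) t (EuclideanSpace.single k 1) =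
      fderiv ℝ f (refMap s j₀ t) (edge s j₀ k) := by
    intro t k
    have h := (hf.differentiable (refMap s j₀ t)).hasFDerivAt.comp t (hasFDerivAt_refMap s j₀ t)
    have h' : fderiv ℝ (fun t => f (refMap s j₀ t)) t = _ := h.fderiv
    rw [h', ContinuousLinearMap.comp_apply, refLinear_single]
  have h0 : refMap s j₀ 0 = s.points j₀ := by simp [refMap]
  obtain ⟨h1, h2⟩ := hb _ hcomp
  simp only [hd, h0] at h1 h2
  simp only [setIntegral_closedInterior_eq s j₀, bary_refMap, ← Finset.mul_sum]
  constructor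
  · intro k
    rw [mul_left_comm]
    exact mul_le_mul_of_nonneg_left (h1 k) (abs_nonneg _)
  · rw [mul_left_comm]
    exact mul_le_mul_of_nonneg_left h2 (abs_nonneg _)

end Transfer

/-! ### Vector-valued polynomials and the weighted energy -/

section VectorPolynomials

variable {d n N : ℕ} {v : E d → E n}

namespace IsVecPoly

lemma contDiff (hv : IsVecPoly N v) : ContDiff ℝ 1 v := contDiff_euclidean.2 fun a => (hv a).contDiff

lemma continuous (hv : IsVecPoly N v) : Continuous v := hv.contDiff.continuous

lemma differentiable (hv : IsVecPoly N v) : Differentiable ℝ v :=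
  hv.contDiff.differentiable (by norm_num)

lemma continuous_fderiv (hv : IsVecPoly N v) : Continuous (fderiv ℝ v) :=
  hv.contDiff.continuous_fderiv (by norm_num)

lemma continuous_fderiv_apply (hv : IsVecPoly N v) (w : E d) :
    Continuous (fun x => fderiv ℝ v x w) :=
  hv.continuous_fderiv.clm_apply continuous_const

lemma fderiv_apply (hv : IsVecPoly N v) (x w : E d) (a : Fin n) :
    fderiv ℝ v x w a = fderiv ℝ (fun y => v y a) x w := by
  have h : HasFDerivAt (fun y => v y a)
      ((EuclideanSpace.proj a : E n →L[ℝ] ℝ).comp (fderiv ℝ v x)) x :=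
    (EuclideanSpace.proj a : E n →L[ℝ] ℝ).hasFDerivAt.comp x (hv.differentiable x).hasFDerivAt
  rw [h.fderiv]
  rfl

lemma sub_const (hv : IsVecPoly N v) (c : E n) : IsVecPoly N (fun x => v x - c) :=
  fun a => by simpa using (hv a).sub (IsPoly.const N (c a))

/-- A polynomial that vanishes almost everywhere on a simplex is zero. -/
lemma eq_zero_of_integral_eq_zero (hv : IsVecPoly N v) (s : Affine.Simplex ℝ (E d) d)
    (h : ∫ x in s.closedInterior, ‖v x‖ ^ 2 = 0) : v = 0 := by
  have hc := hv.continuous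
  have h1 := (setIntegral_eq_zero_iff_of_nonneg_ae (Filter.Eventually.of_forall fun x => by
    positivity) (integrableOn_closedInterior s (f := fun x => ‖v x‖ ^ 2) (by fun_prop))).1 h
  have h2 := Measure.eqOn_open_of_ae_eq
    (ae_restrict_of_ae_restrict_of_subset interior_subset h1) isOpen_interior
    (by fun_prop) continuousOn_const
  obtain ⟨z, hz⟩ := interior_nonempty s
  ext x a
  have hev : (fun y => v y a) =ᶠ[nhds z] fun _ => 0 := by
    filter_upwards [isOpen_interior.mem_nhds hz] with y hy
    have h3 : ‖v y‖ ^ 2 = 0 := h2 hy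
    have h4 : v y = 0 := by simpa using h3
    simp [h4]
  have := (hv a).analyticOnNhd.eq_of_eventuallyEq analyticOnNhd_const hev
  exact congrFun this x

end IsVecPoly

lemma fderiv_eq_sum_partialDeriv (v : E d → E n) (x w : E d) :
    fderiv ℝ v x w = ∑ i, w i • partialDeriv i v x := by
  conv_lhs => rw [← (EuclideanSpace.basisFun (Fin d) ℝ).sum_repr w]
  simp [partialDeriv]

lemma integral_norm_sq_eq_sum (s : Affine.Simplex ℝ (E d) d) {g : E d → E n}
    (hg : ContinuousOn g s.closedInterior) :
    ∫ x in s.closedInterior, ‖g x‖ ^ 2 = ∑ a, ∫ x in s.closedInterior, g x a ^ 2 := by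
  have h : ∀ a, IntegrableOn (fun x => g x a ^ 2) s.closedInterior := fun a =>
    integrableOn_closedInterior s (by fun_prop)
  rw [← integral_finsetSum _ fun a _ => h a]
  simp_rw [EuclideanSpace.real_norm_sq_eq]

/-- The weighted Dirichlet form `∑ ∫ λ_k |∂_{e_k} v|²` over the edges `e_k` at the vertex `j₀`,
where `λ_k` is the barycentric coordinate of the other end of `e_k`. -/
def weightedEnergy (s : Affine.Simplex ℝ (E d) d) (j₀ : Fin (d + 1)) (v : E d → E n) : ℝ :=
  ∑ l, ∫ x in s.closedInterior, bary s (j₀.succAbove l) x * ‖fderiv ℝ v x (edge s j₀ l)‖ ^ 2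

lemma weightedEnergy_nonneg (s : Affine.Simplex ℝ (E d) d) (j₀ : Fin (d + 1)) (v : E d → E n) :
    0 ≤ weightedEnergy s j₀ v :=
  Finset.sum_nonneg fun l _ => setIntegral_nonneg (measurableSet_closedInterior s) fun _ hx =>
    mul_nonneg ((mem_closedInterior_iff s).1 hx _) (by positivity)

lemma exists_weightedEnergy_bound (d N : ℕ) : ∃ C : ℝ, 0 < C ∧
    ∀ (n : ℕ) (s : Affine.Simplex ℝ (E d) d) (j₀ : Fin (d + 1)) (v : E d → E n), IsVecPoly N v →
    (∀ k, ∫ x in s.closedInterior, ‖fderiv ℝ v x (edge s j₀ k)‖ ^ 2 ≤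
      C * weightedEnergy s j₀ v) ∧
    ∫ x in s.closedInterior, ‖v x - v (s.points j₀)‖ ^ 2 ≤ C * weightedEnergy s j₀ v := by
  obtain ⟨C, hC, hb⟩ := exists_simplex_bound d N
  refine ⟨C, hC, fun n s j₀ v hv => ?_⟩
  have hc : ∀ (a : Fin n) (w : E d), Continuous fun x => fderiv ℝ (fun y => v y a) x w :=
    fun a w => (hv a).continuous_fderiv.clm_apply continuous_const
  have henergy : weightedEnergy s j₀ v = ∑ a, ∑ l, ∫ x in s.closedInterior,
      bary s (j₀.succAbove l) x * fderiv ℝ (fun y => v y a) x (edge s j₀ l) ^ 2 := by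
    rw [weightedEnergy, Finset.sum_comm]
    refine Finset.sum_congr rfl fun l _ => ?_
    rw [← integral_finsetSum _ fun a _ => integrableOn_closedInterior s (Continuous.continuousOn
      (by have := hc a (edge s j₀ l); fun_prop))]
    simp_rw [EuclideanSpace.real_norm_sq_eq, hv.fderiv_apply, Finset.mul_sum]
  rw [henergy, Finset.mul_sum]
  constructor
  · intro k
    rw [integral_norm_sq_eq_sum s (hv.continuous_fderiv_apply _).continuousOn]
    simp_rw [hv.fderiv_apply]
    exact Finset.sum_le_sum fun a _ => (hb s j₀ _ (hv a)).1 k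
  · rw [integral_norm_sq_eq_sum s (hv.sub_const _).continuous.continuousOn]
    exact Finset.sum_le_sum fun a _ => (hb s j₀ _ (hv a)).2

end VectorPolynomials

/-! ### The LDG gradient controls the weighted energy -/

section LDG

variable {d n N : ℕ} [NeZero d] (s : Affine.Simplex ℝ (E d) d)

/-- Some face is an outflow face for `v₀`: otherwise all barycentric coordinates would be
nondecreasing along `v₀`, hence constant. -/
lemma exists_outflow_face {v₀ : E d} (hv₀ : v₀ ≠ 0) :
    ∃ j, 0 < inner ℝ v₀ (outwardNormal s j) := by
  by_contra! h
  have hnn : ∀ j, 0 ≤ (bary s j).linear v₀ := by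
    intro j
    rw [linear_bary_eq, real_inner_comm]
    exact div_nonneg (by linarith [h j]) (s.height_pos j).le
  have hz := (Finset.sum_eq_zero_iff_of_nonneg fun j _ => hnn j).1 (sum_linear_bary s v₀)
  apply hv₀
  rw [← sum_linear_bary_smul s 0 v₀]
  exact Finset.sum_eq_zero fun j hj => by rw [hz j hj, zero_smul]

/-- Integration by parts on a simplex in the direction of a coordinate axis. -/
lemma integral_inner_partialDeriv {v w : E d → E n} (hv : ContDiff ℝ 1 v) (hw : ContDiff ℝ 1 w)
    (i : Fin d) :
    (∫ x in s.closedInterior, inner ℝ (v x) (partialDeriv i w x)) +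
      ∫ x in s.closedInterior, inner ℝ (partialDeriv i v x) (w x) =
      ∑ j, outwardNormal s j i * ∫ x, inner ℝ (v x) (w x) ∂(faceMeasure s j) := by
  have hvw : ContDiff ℝ 1 fun x => inner ℝ (v x) (w x) := hv.inner ℝ hw
  have h := integral_fderiv_eq_sum_faces s (f := fun x => inner ℝ (v x) (w x))
    (f' := fderiv ℝ fun x => inner ℝ (v x) (w x))
    (fun x _ => (hvw.differentiable (by norm_num) x).hasFDerivAt)
    (hvw.continuous_fderiv (by norm_num)).continuousOn (EuclideanSpace.single i 1)
  have hcv := hv.continuous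
  have hcw := hw.continuous
  have hdv : Continuous fun x => partialDeriv i v x :=
    (hv.continuous_fderiv (by norm_num)).clm_apply continuous_const
  have hdw : Continuous fun x => partialDeriv i w x :=
    (hw.continuous_fderiv (by norm_num)).clm_apply continuous_const
  have hinner : ∀ j, inner ℝ (outwardNormal s j) (EuclideanSpace.single i (1 : ℝ)) =
      outwardNormal s j i := by
    intro j
    simp [EuclideanSpace.inner_single_right]
  simp_rw [hinner] at h
  rw [← h, ← integral_add (integrableOn_closedInterior s (by fun_prop))
    (integrableOn_closedInterior s (by fun_prop))]
  congr 1
  funext x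
  rw [fderiv_inner_apply ℝ (hv.differentiable (by norm_num) x) (hw.differentiable (by norm_num) x)]
  rfl

variable (j₀ : Fin (d + 1)) (v : E d → E n)

/-- The test function for the `i`-th component of the LDG gradient: the `i`-th component of the
field `∑_l λ_l ∂_{e_l} v ⊗ e_l`, which is tangential on all faces that contain the vertex `j₀`. -/
def testField (i : Fin d) (x : E d) : E n :=
  ∑ l, (bary s (j₀.succAbove l) x * edge s j₀ l i) • fderiv ℝ v x (edge s j₀ l)

variable {v}

omit [NeZero d] in
lemma isVecPoly_testField (hv : IsVecPoly N v) (i : Fin d) :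
    IsVecPoly N (testField s j₀ v i) := by
  intro a
  have h : ∀ x, testField s j₀ v i x a = ∑ l, edge s j₀ l i *
      (bary s (j₀.succAbove l) x * fderiv ℝ (fun y => v y a) x (edge s j₀ l)) := by
    intro x
    simp only [testField, WithLp.ofLp_sum, Finset.sum_apply, PiLp.smul_apply, smul_eq_mul,
      hv.fderiv_apply]
    exact Finset.sum_congr rfl fun l _ => by ring
  simp only [h]
  exact IsPoly.sum _ fun l _ => ((hv a).fderiv_mul _ (IsPoly.affine _) _).const_mul _

/-- The normal component of the test field vanishes on the faces that contain the vertex `j₀`. -/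
lemma sum_normal_smul_testField {j : Fin (d + 1)} (hj : j ≠ j₀) {x : E d} (hx : bary s j x = 0) :
    ∑ i, outwardNormal s j i • testField s j₀ v i x = 0 := by
  obtain ⟨k, rfl⟩ := Fin.exists_succAbove_eq hj
  simp only [testField, Finset.smul_sum, smul_smul]
  rw [Finset.sum_comm]
  refine Finset.sum_eq_zero fun l _ => ?_
  rw [← Finset.sum_smul]
  have h1 : ∑ i, outwardNormal s (j₀.succAbove k) i *
      (bary s (j₀.succAbove l) x * edge s j₀ l i) =
      bary s (j₀.succAbove l) x * inner ℝ (outwardNormal s (j₀.succAbove k)) (edge s j₀ l) := by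
    simp only [PiLp.inner_apply, Finset.mul_sum]
    exact Finset.sum_congr rfl fun i _ => by simp; ring
  rw [h1, inner_outwardNormal_eq, linear_bary_edge]
  split_ifs with h
  · rw [← h, hx]; simp
  · simp

/-- The LDG gradient controls the weighted energy: on the outflow face opposite to `j₀` the
numerical flux is the interior value, and on the other faces the test field is tangential, so no
face terms remain. -/
lemma weightedEnergy_eq_integral {vext : Fin (d + 1) → E d → E n} {Θ : Fin d → E d → E n}
    {v₀ : E d} (hj₀ : 0 < inner ℝ v₀ (outwardNormal s j₀)) (hv : IsVecPoly N v)
    (hext : ∀ j, Integrable (vext j) (faceMeasure s j)) (hΘ : IsLDGGradient s N v₀ v vext Θ) :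
    weightedEnergy s j₀ v = ∑ i, ∫ x in s.closedInterior, inner ℝ (Θ i x) (testField s j₀ v i x) := by
  have hw := fun i => isVecPoly_testField s j₀ hv i
  have hwc := fun i => (hw i).continuous
  have hvc := hv.continuous
  have hpd : ∀ i, Continuous fun x => partialDeriv i v x := fun i => hv.continuous_fderiv_apply _
  -- the numerical flux
  let vhat : Fin (d + 1) → E d → E n := fun j x =>
    avg (v x) (vext j x) - (ldgBeta s v₀ j / 2) • jump (v x) (vext j x)
  have hvhat : ∀ j, Integrable (vhat j) (faceMeasure s j) := by
    intro j
    have hvi := integrable_faceMeasure s hvc.continuousOn j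
    exact (((hext j).add hvi).smul (1 / 2 : ℝ)).sub (((hext j).sub hvi).smul (ldgBeta s v₀ j / 2))
  have hflux : ∀ i j, Integrable
      (fun x => inner ℝ (outwardNormal s j i • vhat j x) (testField s j₀ v i x))
      (faceMeasure s j) := by
    intro i j
    obtain ⟨B, hB⟩ := s.isCompact_closedInterior.exists_bound_of_continuousOn (hwc i).continuousOn
    have hsm := (hvhat j).smul (outwardNormal s j i)
    refine (hsm.norm.mul_const B).mono'
      (hsm.aestronglyMeasurable.inner (hwc i).aestronglyMeasurable) ?_
    filter_upwards [ae_faceMeasure_mem s j] with x hx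
    exact (norm_inner_le_norm _ _).trans
      (mul_le_mul_of_nonneg_left (hB x hx.1) (norm_nonneg _))
  have hvw : ∀ i j, Integrable (fun x => inner ℝ (v x) (testField s j₀ v i x)) (faceMeasure s j) :=
    fun i j => integrable_faceMeasure s (by have := hwc i; fun_prop) j
  have hface : ∀ j, ∑ i, ((∫ x, inner ℝ (outwardNormal s j i • vhat j x) (testField s j₀ v i x)
      ∂(faceMeasure s j)) - outwardNormal s j i *
        ∫ x, inner ℝ (v x) (testField s j₀ v i x) ∂(faceMeasure s j)) = 0 := by
    intro j
    have hsub : ∀ i, Integrable (fun x =>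
        inner ℝ (outwardNormal s j i • vhat j x) (testField s j₀ v i x) -
          outwardNormal s j i * inner ℝ (v x) (testField s j₀ v i x)) (faceMeasure s j) :=
      fun i => (hflux i j).sub ((hvw i j).const_mul _)
    rw [Finset.sum_congr rfl fun i _ => (by
      rw [← integral_const_mul, ← integral_sub (hflux i j) ((hvw i j).const_mul _)] :
      _ = ∫ x, (inner ℝ (outwardNormal s j i • vhat j x) (testField s j₀ v i x) -
        outwardNormal s j i * inner ℝ (v x) (testField s j₀ v i x)) ∂(faceMeasure s j)),
      ← integral_finsetSum _ fun i _ => hsub i]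
    refine integral_eq_zero_of_ae ?_
    filter_upwards [ae_faceMeasure_mem s j] with x hx
    have h1 : ∀ i, inner ℝ (outwardNormal s j i • vhat j x) (testField s j₀ v i x) -
        outwardNormal s j i * inner ℝ (v x) (testField s j₀ v i x) =
        inner ℝ (vhat j x - v x) (outwardNormal s j i • testField s j₀ v i x) := by
      intro i
      rw [real_inner_smul_left, real_inner_smul_right, inner_sub_left (vhat j x) (v x)]; ring
    simp only [h1, ← inner_sum, Pi.zero_apply]
    by_cases hj : j = j₀
    · have hβ : ldgBeta s v₀ j = 1 := by rw [ldgBeta, hj, Real.sign_of_pos hj₀]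
      have h2 : vhat j x - v x = 0 := by
        simp only [vhat, avg, jump, hβ]
        module
      rw [h2, inner_zero_left]
    · rw [sum_normal_smul_testField s j₀ hj hx.2, inner_zero_right]
  have hstep : ∀ i, ∫ x in s.closedInterior, inner ℝ (Θ i x) (testField s j₀ v i x) =
      (∫ x in s.closedInterior, inner ℝ (partialDeriv i v x) (testField s j₀ v i x)) +
      ∑ j, ((∫ x, inner ℝ (outwardNormal s j i • vhat j x) (testField s j₀ v i x)
        ∂(faceMeasure s j)) - outwardNormal s j i *
          ∫ x, inner ℝ (v x) (testField s j₀ v i x) ∂(faceMeasure s j)) := by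
    intro i
    have h1 := (hΘ i).2 _ (hw i)
    have h2 := integral_inner_partialDeriv s hv.contDiff (hw i).contDiff i
    simp only [inner_neg_left, integral_neg] at h1
    rw [Finset.sum_sub_distrib, ← h2, h1]
    ring
  have hint₁ : ∀ i, IntegrableOn (fun x => inner ℝ (partialDeriv i v x) (testField s j₀ v i x))
      s.closedInterior := fun i =>
    integrableOn_closedInterior s ((hpd i).inner (hwc i)).continuousOn
  have hint₂ : ∀ l, IntegrableOn (fun x => bary s (j₀.succAbove l) x *
      ‖fderiv ℝ v x (edge s j₀ l)‖ ^ 2) s.closedInterior := fun l =>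
    integrableOn_closedInterior s ((continuous_bary s _).mul
      ((hv.continuous_fderiv_apply _).norm.pow 2)).continuousOn
  rw [Finset.sum_congr rfl fun i _ => hstep i, Finset.sum_add_distrib, Finset.sum_comm (γ := Fin d),
    Finset.sum_eq_zero fun j _ => hface j, add_zero, weightedEnergy,
    ← integral_finsetSum _ fun i _ => hint₁ i, ← integral_finsetSum _ fun i _ => hint₂ i]
  congr 1
  funext x
  have h3 : ∀ i, inner ℝ (partialDeriv i v x) (testField s j₀ v i x) =
      ∑ l, bary s (j₀.succAbove l) x *
        inner ℝ (edge s j₀ l i • partialDeriv i v x) (fderiv ℝ v x (edge s j₀ l)) := by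
    intro i
    rw [testField, inner_sum]
    refine Finset.sum_congr rfl fun l _ => ?_
    rw [real_inner_smul_right, real_inner_smul_left]; ring
  simp_rw [h3]
  rw [Finset.sum_comm]
  refine Finset.sum_congr rfl fun l _ => ?_
  rw [← Finset.mul_sum, ← sum_inner, ← fderiv_eq_sum_partialDeriv, real_inner_self_eq_norm_sq]

omit [NeZero d] in
lemma norm_edge_le (l : Fin d) : ‖edge s j₀ l‖ ≤ elementSize s := by
  rw [edge, ← dist_eq_norm]
  exact Metric.dist_le_diam_of_mem s.isCompact_closedInterior.isBounded
    (s.point_mem_closedInterior _) (s.point_mem_closedInterior _)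

omit [NeZero d] in
lemma norm_sum_smul_sq_le {F ι : Type*} [NormedAddCommGroup F] [NormedSpace ℝ F] [Fintype ι]
    (c : ι → ℝ) (z : ι → F) : ‖∑ i, c i • z i‖ ^ 2 ≤ (∑ i, c i ^ 2) * ∑ i, ‖z i‖ ^ 2 := by
  have h1 : ‖∑ i, c i • z i‖ ≤ ∑ i, |c i| * ‖z i‖ :=
    (norm_sum_le _ _).trans_eq (Finset.sum_congr rfl fun i _ => by rw [norm_smul, Real.norm_eq_abs])
  refine (pow_le_pow_left₀ (norm_nonneg _) h1 2).trans ?_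
  simpa using Finset.sum_mul_sq_le_sq_mul_sq Finset.univ (fun i => |c i|) (fun i => ‖z i‖)

/-- The weighted energy is bounded by `h² ‖Θ‖²`. -/
lemma weightedEnergy_le {vext : Fin (d + 1) → E d → E n} {Θ : Fin d → E d → E n}
    {v₀ : E d} (hj₀ : 0 < inner ℝ v₀ (outwardNormal s j₀)) (hv : IsVecPoly N v)
    (hext : ∀ j, Integrable (vext j) (faceMeasure s j)) (hΘ : IsLDGGradient s N v₀ v vext Θ) :
    weightedEnergy s j₀ v ≤
      elementSize s ^ 2 * ∫ x in s.closedInterior, ∑ i, ‖Θ i x‖ ^ 2 := by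
  have hw := fun i => (isVecPoly_testField s j₀ hv i).continuous
  have hΘc := fun i => (hΘ i).1.continuous
  have hdc := fun l => hv.continuous_fderiv_apply (edge s j₀ l)
  have hint₁ : ∀ i, IntegrableOn (fun x => inner ℝ (Θ i x) (testField s j₀ v i x))
      s.closedInterior := fun i =>
    integrableOn_closedInterior s ((hΘc i).inner (hw i)).continuousOn
  have hint₂ : ∀ l, IntegrableOn (fun x => bary s (j₀.succAbove l) x *
      ‖fderiv ℝ v x (edge s j₀ l)‖ ^ 2) s.closedInterior := fun l =>
    integrableOn_closedInterior s ((continuous_bary s _).mul ((hdc l).norm.pow 2)).continuousOn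
  have hwe : weightedEnergy s j₀ v = ∫ x in s.closedInterior,
      ∑ l, bary s (j₀.succAbove l) x * ‖fderiv ℝ v x (edge s j₀ l)‖ ^ 2 := by
    rw [weightedEnergy, integral_finsetSum _ fun l _ => hint₂ l]
  have h1 := weightedEnergy_eq_integral s j₀ hj₀ hv hext hΘ
  rw [← integral_finsetSum _ fun i _ => hint₁ i] at h1
  have h2 : ∫ x in s.closedInterior, ∑ i, inner ℝ (Θ i x) (testField s j₀ v i x) ≤
      ∫ x in s.closedInterior, ((1 / 2) * (elementSize s ^ 2 * ∑ i, ‖Θ i x‖ ^ 2) +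
        (1 / 2) * ∑ l, bary s (j₀.succAbove l) x * ‖fderiv ℝ v x (edge s j₀ l)‖ ^ 2) := by
    refine setIntegral_mono_on (integrableOn_closedInterior s (by fun_prop))
      (integrableOn_closedInterior s (by fun_prop)) (measurableSet_closedInterior s) fun x hx => ?_
    have hb := (mem_closedInterior_iff s).1 hx
    have hsum : ∑ l, bary s (j₀.succAbove l) x ≤ 1 := by
      have := sum_bary s x
      rw [Fin.sum_univ_succAbove _ j₀] at this
      linarith [hb j₀]
    set T := ∑ i, ‖Θ i x‖ ^ 2 with hT
    have hT0 : 0 ≤ T := Finset.sum_nonneg fun i _ => by positivity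
    have hre : ∑ i, inner ℝ (Θ i x) (testField s j₀ v i x) = ∑ l, bary s (j₀.succAbove l) x *
        inner ℝ (∑ i, edge s j₀ l i • Θ i x) (fderiv ℝ v x (edge s j₀ l)) := by
      simp_rw [testField, inner_sum, sum_inner, Finset.mul_sum]
      rw [Finset.sum_comm]
      refine Finset.sum_congr rfl fun l _ => Finset.sum_congr rfl fun i _ => ?_
      rw [real_inner_smul_right, real_inner_smul_left]; ring
    have hle : ∀ l, bary s (j₀.succAbove l) x *
        inner ℝ (∑ i, edge s j₀ l i • Θ i x) (fderiv ℝ v x (edge s j₀ l)) ≤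
        bary s (j₀.succAbove l) x * ((1 / 2) * (elementSize s ^ 2 * T)) +
        (1 / 2) * (bary s (j₀.succAbove l) x * ‖fderiv ℝ v x (edge s j₀ l)‖ ^ 2) := by
      intro l
      have hg : ‖∑ i, edge s j₀ l i • Θ i x‖ ^ 2 ≤ elementSize s ^ 2 * T := by
        refine (norm_sum_smul_sq_le _ _).trans (mul_le_mul_of_nonneg_right ?_ hT0)
        rw [← EuclideanSpace.real_norm_sq_eq]
        exact pow_le_pow_left₀ (norm_nonneg _) (norm_edge_le s j₀ l) 2
      have hi := real_inner_le_norm (∑ i, edge s j₀ l i • Θ i x) (fderiv ℝ v x (edge s j₀ l))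
      have hy := two_mul_le_add_sq ‖∑ i, edge s j₀ l i • Θ i x‖ ‖fderiv ℝ v x (edge s j₀ l)‖
      have := mul_le_mul_of_nonneg_left (show
        inner ℝ (∑ i, edge s j₀ l i • Θ i x) (fderiv ℝ v x (edge s j₀ l)) ≤
          (1 / 2) * (elementSize s ^ 2 * T) + (1 / 2) * ‖fderiv ℝ v x (edge s j₀ l)‖ ^ 2 by
            linarith) (hb (j₀.succAbove l))
      linarith
    rw [hre]
    refine (Finset.sum_le_sum fun l _ => hle l).trans ?_
    rw [Finset.sum_add_distrib, ← Finset.sum_mul, ← Finset.mul_sum]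
    have : 0 ≤ (1 / 2) * (elementSize s ^ 2 * T) := by positivity
    nlinarith
  rw [integral_add (integrableOn_closedInterior s (by fun_prop))
    (integrableOn_closedInterior s (by fun_prop)), integral_const_mul, integral_const_mul,
    integral_const_mul, ← hwe, ← h1] at h2
  linarith

end LDG

/-! ### The entropy residual -/

section Residual

variable {d n N : ℕ} [NeZero d] (L : EntropySystem d n) (s : Affine.Simplex ℝ (E d) d)
  {uh vh : E d → E n}

omit [NeZero d] in
lemma continuousOn_flux_states (huh : Continuous uh) (hst : ∀ x ∈ s.closedInterior, uh x ∈ L.states)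
    (i : Fin d) : ContinuousOn (fun x => L.flux i (uh x)) s.closedInterior := fun x hx =>
  ((L.differentiableAt_flux i (hst x hx)).continuousAt.comp
    huh.continuousAt).continuousWithinAt

omit [NeZero d] in
lemma continuousOn_flux_projection (hvh : Continuous vh)
    (hmem : ∀ x ∈ s.closedInterior, vh x ∈ L.entropyStates) (i : Fin d) :
    ContinuousOn (fun x => L.flux i (L.conservativeVar (vh x))) s.closedInterior := fun x hx =>
  ((L.differentiableAt_flux_conservativeVar i (hmem x hx)).continuousAt.comp
    hvh.continuousAt).continuousWithinAt

omit [NeZero d] in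
lemma continuousOn_entropyVar_comp (huh : Continuous uh)
    (hst : ∀ x ∈ s.closedInterior, uh x ∈ L.states) :
    ContinuousOn (fun x => L.entropyVar (uh x)) s.closedInterior :=
  L.continuousOn_entropyVar.comp huh.continuousOn hst

/-- Since the flux is the gradient of the entropy potential in the entropy variables, the
divergence theorem turns the boundary term of the entropy residual into a volume term. -/
lemma entropyResidual_eq (huh : Continuous uh) (hst : ∀ x ∈ s.closedInterior, uh x ∈ L.states)
    (hvh : ContDiff ℝ 1 vh) (hmem : ∀ x ∈ s.closedInterior, vh x ∈ L.entropyStates) :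
    entropyResidual L s uh vh = ∑ i, ∫ x in s.closedInterior,
      inner ℝ (L.flux i (L.conservativeVar (vh x)) - L.flux i (uh x)) (partialDeriv i vh x) := by
  refine Finset.sum_congr rfl fun i _ => ?_
  have hc₁ := continuousOn_flux_states L s huh hst i
  have hc₂ := continuousOn_flux_projection L s hvh.continuous hmem i
  have hdf : Continuous (fderiv ℝ vh) := hvh.continuous_fderiv (by norm_num)
  have hd : Continuous (fun x => partialDeriv i vh x) := hdf.clm_apply continuous_const
  have hdiv := integral_fderiv_eq_sum_faces s
    (f := fun x => L.potential i (L.conservativeVar (vh x)))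
    (f' := fun x => (innerSL ℝ (L.flux i (L.conservativeVar (vh x)))).comp (fderiv ℝ vh x))
    (fun x hx => (L.hasFDerivAt_potential i (hmem x hx)).comp x
      (hvh.differentiable (by norm_num) x).hasFDerivAt)
    (((innerSL ℝ).continuous.comp_continuousOn hc₂).clm_comp hdf.continuousOn)
    (EuclideanSpace.single i 1)
  have hinner : ∀ j, inner ℝ (outwardNormal s j) (EuclideanSpace.single i (1 : ℝ)) =
      outwardNormal s j i := by
    intro j
    simp [EuclideanSpace.inner_single_right]
  have hface : ∑ j, ∫ x, L.potential i (L.conservativeVar (vh x)) * outwardNormal s j i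
      ∂(faceMeasure s j) = ∫ x in s.closedInterior,
        inner ℝ (L.flux i (L.conservativeVar (vh x))) (partialDeriv i vh x) := by
    simp_rw [integral_mul_const, mul_comm _ (outwardNormal s _ i), ← hinner]
    exact hdiv.symm
  rw [hface, ← integral_add (integrableOn_closedInterior s (hc₁.neg.inner hd.continuousOn))
    (integrableOn_closedInterior s (hc₂.inner hd.continuousOn))]
  congr 1
  funext x
  rw [inner_sub_left, inner_neg_left]
  ring

omit [NeZero d] in
lemma fluxJacobianNorm_nonneg (i : Fin d) : 0 ≤ fluxJacobianNorm L s uh vh i :=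
  Real.sSup_nonneg (by rintro _ ⟨w, _, rfl⟩; exact norm_nonneg _)

omit [NeZero d] in
lemma norm_flux_sub_le (hst : ∀ x ∈ s.closedInterior, uh x ∈ L.states)
    (hseg : entropySegments L s uh vh ⊆ L.entropyStates) (i : Fin d)
    (hbdd : BddAbove ((fun w => ‖L.fluxJacobian i w‖) '' entropySegments L s uh vh))
    {x : E d} (hx : x ∈ s.closedInterior) :
    ‖L.flux i (L.conservativeVar (vh x)) - L.flux i (uh x)‖ ≤
      fluxJacobianNorm L s uh vh i * ‖L.entropyVar (uh x) - vh x‖ := by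
  have hsub : segment ℝ (L.entropyVar (uh x)) (vh x) ⊆ entropySegments L s uh vh :=
    Set.subset_biUnion_of_mem (u := fun x => segment ℝ (L.entropyVar (uh x)) (vh x)) hx
  have h := (convex_segment (L.entropyVar (uh x)) (vh x)).norm_image_sub_le_of_norm_fderiv_le
    (𝕜 := ℝ) (f := fun z => L.flux i (L.conservativeVar z)) (C := fluxJacobianNorm L s uh vh i)
    (fun w hw => L.differentiableAt_flux_conservativeVar i (hseg (hsub hw)))
    (fun w hw => le_csSup hbdd ⟨w, hsub hw, rfl⟩) (left_mem_segment ℝ _ _) (right_mem_segment ℝ _ _)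
  rwa [L.conservativeVar_entropyVar (hst x hx), norm_sub_rev (vh x)] at h

omit [NeZero d] in
lemma integral_mul_le_sqrt_mul_sqrt {f g : E d → ℝ} (hf : ContinuousOn f s.closedInterior)
    (hg : ContinuousOn g s.closedInterior) (hf0 : ∀ x, 0 ≤ f x) (hg0 : ∀ x, 0 ≤ g x) :
    ∫ x in s.closedInterior, f x * g x ≤
      √(∫ x in s.closedInterior, f x ^ 2) * √(∫ x in s.closedInterior, g x ^ 2) := by
  have hmem : ∀ {k : E d → ℝ}, ContinuousOn k s.closedInterior →
      MemLp k (ENNReal.ofReal 2) (volume.restrict s.closedInterior) := by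
    intro k hk
    have : IsFiniteMeasure (volume.restrict s.closedInterior) :=
      ⟨by simpa using volume_closedInterior_lt_top s⟩
    obtain ⟨B, hB⟩ := s.isCompact_closedInterior.exists_bound_of_continuousOn hk
    exact MemLp.of_bound (hk.aestronglyMeasurable (measurableSet_closedInterior s)) B
      ((ae_restrict_iff' (measurableSet_closedInterior s)).2 (Filter.Eventually.of_forall hB))
  have h := integral_mul_le_Lp_mul_Lq_of_nonneg (μ := volume.restrict s.closedInterior)
    Real.HolderConjugate.two_two (Filter.Eventually.of_forall hf0)
    (Filter.Eventually.of_forall hg0) (hmem hf) (hmem hg)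
  simpa [Real.sqrt_eq_rpow] using h

/-- The negative part of the entropy residual is at most `‖∂f/∂v‖` times the projection error times
the `L²` norm of the gradient of `v_h`. -/
lemma neg_min_entropyResidual_le (huh : Continuous uh)
    (hst : ∀ x ∈ s.closedInterior, uh x ∈ L.states) (hvh : ContDiff ℝ 1 vh)
    (hseg : entropySegments L s uh vh ⊆ L.entropyStates)
    (hbdd : ∀ i, BddAbove ((fun w => ‖L.fluxJacobian i w‖) '' entropySegments L s uh vh)) :
    -min 0 (entropyResidual L s uh vh) ≤
      √(∑ i, fluxJacobianNorm L s uh vh i ^ 2) *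
        √(∫ x in s.closedInterior, ‖L.entropyVar (uh x) - vh x‖ ^ 2) *
        √(∑ i, ∫ x in s.closedInterior, ‖partialDeriv i vh x‖ ^ 2) := by
  have hmem : ∀ x ∈ s.closedInterior, vh x ∈ L.entropyStates := fun x hx =>
    hseg (Set.mem_biUnion hx (right_mem_segment ℝ _ _))
  have hd : ∀ i, Continuous (fun x => partialDeriv i vh x) := fun i =>
    (hvh.continuous_fderiv (by norm_num)).clm_apply continuous_const
  have hV := continuousOn_entropyVar_comp L s huh hst
  have hX : ContinuousOn (fun x => ‖L.entropyVar (uh x) - vh x‖) s.closedInterior :=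
    (hV.sub hvh.continuous.continuousOn).norm
  set X := √(∫ x in s.closedInterior, ‖L.entropyVar (uh x) - vh x‖ ^ 2) with hXdef
  have hterm : ∀ i, -(fluxJacobianNorm L s uh vh i * (X *
      √(∫ x in s.closedInterior, ‖partialDeriv i vh x‖ ^ 2))) ≤ ∫ x in s.closedInterior,
      inner ℝ (L.flux i (L.conservativeVar (vh x)) - L.flux i (uh x)) (partialDeriv i vh x) := by
    intro i
    have hJ := fluxJacobianNorm_nonneg L s (uh := uh) (vh := vh) i
    have h1 := integral_mul_le_sqrt_mul_sqrt s hX (hd i).norm.continuousOn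
      (fun _ => norm_nonneg _) (fun _ => norm_nonneg _)
    refine (neg_le_neg (mul_le_mul_of_nonneg_left h1 hJ)).trans ?_
    rw [← integral_const_mul, ← integral_neg]
    have hint : IntegrableOn (fun x => -(fluxJacobianNorm L s uh vh i *
        (‖L.entropyVar (uh x) - vh x‖ * ‖partialDeriv i vh x‖))) s.closedInterior :=
      integrableOn_closedInterior s
        (continuousOn_const.mul (hX.mul (hd i).norm.continuousOn)).neg
    refine setIntegral_mono_on hint (integrableOn_closedInterior s
      (((continuousOn_flux_projection L s hvh.continuous hmem i).sub
        (continuousOn_flux_states L s huh hst i)).inner (hd i).continuousOn))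
      (measurableSet_closedInterior s) fun x hx => ?_
    have h2 := norm_flux_sub_le L s hst hseg i (hbdd i) hx
    have h3 := neg_le_of_abs_le (abs_real_inner_le_norm
      (L.flux i (L.conservativeVar (vh x)) - L.flux i (uh x)) (partialDeriv i vh x))
    have h4 := mul_le_mul_of_nonneg_right h2 (norm_nonneg (partialDeriv i vh x))
    linarith
  have hres : -(√(∑ i, fluxJacobianNorm L s uh vh i ^ 2) * X *
      √(∑ i, ∫ x in s.closedInterior, ‖partialDeriv i vh x‖ ^ 2)) ≤
      entropyResidual L s uh vh := by
    rw [entropyResidual_eq L s huh hst hvh hmem]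
    refine le_trans ?_ (Finset.sum_le_sum fun i _ => hterm i)
    rw [Finset.sum_neg_distrib, neg_le_neg_iff]
    have h5 := Real.sum_mul_le_sqrt_mul_sqrt Finset.univ (fluxJacobianNorm L s uh vh)
      (fun i => √(∫ x in s.closedInterior, ‖partialDeriv i vh x‖ ^ 2))
    have h6 : ∀ i, √(∫ x in s.closedInterior, ‖partialDeriv i vh x‖ ^ 2) ^ 2 =
        ∫ x in s.closedInterior, ‖partialDeriv i vh x‖ ^ 2 := fun i =>
      Real.sq_sqrt (integral_nonneg fun x => by positivity)
    simp only [h6] at h5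
    have h7 := mul_le_mul_of_nonneg_left h5 (Real.sqrt_nonneg _ : 0 ≤ X)
    rw [Finset.mul_sum] at h7
    calc _ = ∑ i, X * (fluxJacobianNorm L s uh vh i *
          √(∫ x in s.closedInterior, ‖partialDeriv i vh x‖ ^ 2)) :=
          Finset.sum_congr rfl fun i _ => by ring
      _ ≤ _ := h7
      _ = _ := by ring
  have hnn : 0 ≤ √(∑ i, fluxJacobianNorm L s uh vh i ^ 2) * X *
      √(∑ i, ∫ x in s.closedInterior, ‖partialDeriv i vh x‖ ^ 2) := by positivity
  rw [neg_le]
  exact le_min (by linarith) hres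

end Residual

/-! ### Shape regularity and the gradient -/

section Gradient

variable {d n N : ℕ} (s : Affine.Simplex ℝ (E d) d) (j₀ : Fin (d + 1))

/-- On a shape regular simplex the barycentric coordinates have derivatives of size `1/h`. -/
lemma elementSize_mul_linear_bary_sq_le {σ : ℝ} (hs : ShapeRegular s σ) (j : Fin (d + 1)) {w : E d}
    (hw : ‖w‖ = 1) : (elementSize s * (bary s j).linear w) ^ 2 ≤ σ ^ 2 := by
  obtain ⟨c, ρ, hρ, hsize, hball⟩ := hs
  have hc : c ∈ s.closedInterior := hball (Metric.mem_closedBall_self hρ.le)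
  have hcw : c + ρ • w ∈ s.closedInterior := hball (by
    rw [Metric.mem_closedBall, dist_self_add_left, norm_smul, hw, Real.norm_eq_abs, abs_of_pos hρ,
      mul_one])
  have h1 := bary_le_one s hcw j
  have h2 := (mem_closedInterior_iff s).1 hcw j
  have h3 := bary_le_one s hc j
  have h4 := (mem_closedInterior_iff s).1 hc j
  rw [bary_add, map_smul, smul_eq_mul] at h1 h2
  have hh : 0 ≤ elementSize s := Metric.diam_nonneg
  have hσ : 0 ≤ σ := by
    by_contra hneg
    nlinarith
  have habs : |ρ * (bary s j).linear w| ≤ 1 := abs_le.2 ⟨by linarith, by linarith⟩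
  rw [abs_mul, abs_of_pos hρ] at habs
  rw [sq_le_sq, abs_mul, abs_of_nonneg hh, abs_of_nonneg hσ]
  calc elementSize s * |(bary s j).linear w| ≤ σ * ρ * |(bary s j).linear w| :=
        mul_le_mul_of_nonneg_right hsize (abs_nonneg _)
    _ = σ * (ρ * |(bary s j).linear w|) := by ring
    _ ≤ σ := mul_le_of_le_one_right hσ habs

lemma elementSize_pos [NeZero d] : 0 < elementSize s := by
  refine lt_of_lt_of_le (norm_pos_iff.2 ?_) (norm_edge_le s 0 0)
  intro h
  have := linear_bary_edge s 0 (0 : Fin d) 0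
  rw [h] at this
  simp at this

/-- The gradient in terms of the derivatives along the edges at one vertex. -/
lemma elementSize_sq_mul_sum_integral_le {σ : ℝ} (hs : ShapeRegular s σ) {v : E d → E n}
    (hv : IsVecPoly N v) {B : ℝ}
    (hB : ∀ k, ∫ x in s.closedInterior, ‖fderiv ℝ v x (edge s j₀ k)‖ ^ 2 ≤ B) :
    elementSize s ^ 2 * ∑ i, ∫ x in s.closedInterior, ‖partialDeriv i v x‖ ^ 2 ≤
      d ^ 3 * σ ^ 2 * B := by
  have hint : ∀ k, IntegrableOn (fun x => ‖fderiv ℝ v x (edge s j₀ k)‖ ^ 2) s.closedInterior :=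
    fun k => integrableOn_closedInterior s ((hv.continuous_fderiv_apply _).norm.pow 2).continuousOn
  have hi : ∀ i, elementSize s ^ 2 * ∫ x in s.closedInterior, ‖partialDeriv i v x‖ ^ 2 ≤
      d * σ ^ 2 * (d * B) := by
    intro i
    have hpt : ∀ x, elementSize s ^ 2 * ‖partialDeriv i v x‖ ^ 2 ≤
        d * σ ^ 2 * ∑ k, ‖fderiv ℝ v x (edge s j₀ k)‖ ^ 2 := by
      intro x
      have hei : (EuclideanSpace.single i (1 : ℝ) : E d) = ∑ k, (bary s (j₀.succAbove k)).linear
          (EuclideanSpace.single i (1 : ℝ)) • edge s j₀ k := by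
        have := sum_linear_bary_smul s j₀ (EuclideanSpace.single i (1 : ℝ))
        rw [Fin.sum_univ_succAbove _ j₀, sub_self, smul_zero, zero_add] at this
        exact this.symm
      have h1 : elementSize s • partialDeriv i v x = ∑ k, (elementSize s *
          (bary s (j₀.succAbove k)).linear (EuclideanSpace.single i (1 : ℝ))) •
            fderiv ℝ v x (edge s j₀ k) := by
        rw [partialDeriv]
        conv_lhs => rw [hei]
        simp_rw [map_sum, map_smul, Finset.smul_sum, smul_smul]
      rw [← sq_abs (elementSize s), ← Real.norm_eq_abs, ← mul_pow, ← norm_smul, h1]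
      refine (norm_sum_smul_sq_le _ _).trans (mul_le_mul_of_nonneg_right ?_
        (Finset.sum_nonneg fun k _ => by positivity))
      refine (Finset.sum_le_sum fun k _ =>
        elementSize_mul_linear_bary_sq_le s hs _ (by simp)).trans ?_
      simp
    rw [← integral_const_mul]
    have hpd : Continuous fun x => partialDeriv i v x := hv.continuous_fderiv_apply _
    refine (setIntegral_mono_on (integrableOn_closedInterior s (by fun_prop))
      ((integrable_finsetSum _ fun k _ => hint k).const_mul _) (measurableSet_closedInterior s)
      fun x _ => hpt x).trans ?_
    rw [integral_const_mul, integral_finsetSum _ fun k _ => hint k]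
    refine mul_le_mul_of_nonneg_left ((Finset.sum_le_sum fun k _ => hB k).trans ?_) (by positivity)
    simp
  rw [Finset.mul_sum]
  refine (Finset.sum_le_sum fun i _ => hi i).trans (le_of_eq ?_)
  simp
  ring

end Gradient

/-! ### The projection of the deviation from the mean -/

section Projection

variable {d n N : ℕ} (s : Affine.Simplex ℝ (E d) d) {g p q : E d → E n}

/-- The `L²` projection commutes with subtraction of a constant, and is unique. -/
lemma IsL2Projection.eq_sub_const {c : E n} (hg : ContinuousOn g s.closedInterior)
    (hp : IsL2Projection s.closedInterior N g p)
    (hq : IsL2Projection s.closedInterior N (fun x => g x - c) q) (x : E d) : q x = p x - c := by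
  have hr : IsVecPoly N (fun x => q x - (p x - c)) := fun a => by
    simpa using (hq.1 a).sub ((hp.1.sub_const c) a)
  have hzero : ∫ x in s.closedInterior, ‖q x - (p x - c)‖ ^ 2 = 0 := by
    rw [integral_norm_sq_eq_sum s hr.continuous.continuousOn]
    refine Finset.sum_eq_zero fun a _ => ?_
    let r : E d → ℝ := fun x => (q x - (p x - c)) a
    have hcr : Continuous r := (hr a).continuous
    have hcq := (hq.1 a).continuous
    have hcp := (hp.1 a).continuous
    have hga : ContinuousOn (fun x => g x a) s.closedInterior := by fun_prop
    have i1 : IntegrableOn (fun x => q x a * r x) s.closedInterior :=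
      integrableOn_closedInterior s (hcq.mul hcr).continuousOn
    have i2 : IntegrableOn (fun x => p x a * r x) s.closedInterior :=
      integrableOn_closedInterior s (hcp.mul hcr).continuousOn
    have i3 : IntegrableOn (fun x => c a * r x) s.closedInterior :=
      integrableOn_closedInterior s (continuous_const.mul hcr).continuousOn
    have i4 : IntegrableOn (fun x => g x a * r x) s.closedInterior :=
      integrableOn_closedInterior s (hga.mul hcr.continuousOn)
    have h1 : ∫ x in s.closedInterior, q x a * r x =
        ∫ x in s.closedInterior, (g x a * r x - c a * r x) := by
      rw [hq.2 r (hr a) a]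
      congr 1
      funext x
      simp only [PiLp.sub_apply]
      ring
    have h2 : ∫ x in s.closedInterior, p x a * r x = ∫ x in s.closedInterior, g x a * r x :=
      hp.2 r (hr a) a
    have e1 : ∫ x in s.closedInterior, r x ^ 2 =
        ∫ x in s.closedInterior, (q x a * r x - (p x a * r x - c a * r x)) := by
      congr 1
      funext x
      simp only [r, PiLp.sub_apply]
      ring
    change ∫ x in s.closedInterior, r x ^ 2 = 0
    have i5 : IntegrableOn (fun x => p x a * r x - c a * r x) s.closedInterior := i2.sub i3
    rw [e1, integral_sub i1 i5, integral_sub i2 i3, h1, integral_sub i4 i3, h2]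
    ring
  have := congrFun (hr.eq_zero_of_integral_eq_zero s hzero) x
  exact sub_eq_zero.1 this

/-- Pythagoras for the `L²` projection. -/
lemma IsL2Projection.integral_norm_sub_sq (hg : ContinuousOn g s.closedInterior)
    (hp : IsL2Projection s.closedInterior N g p) :
    ∫ x in s.closedInterior, ‖g x - p x‖ ^ 2 =
      normSqL2 s.closedInterior g - normSqL2 s.closedInterior p := by
  have hpc := hp.1.continuous
  rw [normSqL2, normSqL2, integral_norm_sq_eq_sum s hg,
    integral_norm_sq_eq_sum s hpc.continuousOn,
    integral_norm_sq_eq_sum s (g := fun x => g x - p x) (hg.sub hpc.continuousOn), ← Finset.sum_sub_distrib]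
  refine Finset.sum_congr rfl fun a _ => ?_
  have hca := (hp.1 a).continuous.continuousOn (s := s.closedInterior)
  have hga : ContinuousOn (fun x => g x a) s.closedInterior := by fun_prop
  have h := hp.2 _ (hp.1 a) a
  have i1 : IntegrableOn (fun x => g x a ^ 2) s.closedInterior :=
    integrableOn_closedInterior s (hga.pow 2)
  have i2 : IntegrableOn (fun x => 2 * (g x a * p x a)) s.closedInterior :=
    integrableOn_closedInterior s (continuousOn_const.mul (hga.mul hca))
  have i3 : IntegrableOn (fun x => p x a * p x a) s.closedInterior :=
    integrableOn_closedInterior s (hca.mul hca)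
  have i4 : IntegrableOn (fun x => g x a ^ 2 - 2 * (g x a * p x a)) s.closedInterior := i1.sub i2
  have e1 : ∫ x in s.closedInterior, (g x - p x) a ^ 2 =
      ∫ x in s.closedInterior, (g x a ^ 2 - 2 * (g x a * p x a) + p x a * p x a) := by
    congr 1
    funext x
    simp only [PiLp.sub_apply]
    ring
  rw [e1, integral_add i4 i3, integral_sub i1 i2, integral_const_mul, ← h]
  simp only [sq]
  ring

/-- The mean minimizes the `L²` distance to the constants. -/
lemma integral_norm_sq_le_of_mean_zero (hg : ContinuousOn g s.closedInterior)
    (hmean : ∀ a, ∫ x in s.closedInterior, g x a = 0) (c : E n) :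
    ∫ x in s.closedInterior, ‖g x‖ ^ 2 ≤ ∫ x in s.closedInterior, ‖g x - c‖ ^ 2 := by
  rw [integral_norm_sq_eq_sum s hg, integral_norm_sq_eq_sum s (g := fun x => g x - c) (hg.sub continuousOn_const)]
  refine Finset.sum_le_sum fun a _ => ?_
  have hga : ContinuousOn (fun x => g x a) s.closedInterior := by fun_prop
  have i1 : IntegrableOn (fun x => g x a ^ 2) s.closedInterior :=
    integrableOn_closedInterior s (hga.pow 2)
  have i2 : IntegrableOn (fun x => 2 * c a * g x a) s.closedInterior :=
    integrableOn_closedInterior s (continuousOn_const.mul hga)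
  have i3 : IntegrableOn (fun _ => c a ^ 2) s.closedInterior :=
    integrableOn_closedInterior s continuousOn_const
  have i4 : IntegrableOn (fun x => g x a ^ 2 - 2 * c a * g x a) s.closedInterior := i1.sub i2
  have e1 : ∫ x in s.closedInterior, (g x - c) a ^ 2 =
      ∫ x in s.closedInterior, (g x a ^ 2 - 2 * c a * g x a + c a ^ 2) := by
    congr 1
    funext x
    simp only [PiLp.sub_apply]
    ring
  rw [e1, integral_add i4 i3, integral_sub i1 i2, integral_const_mul, hmean a]
  have : 0 ≤ ∫ x in s.closedInterior, c a ^ 2 := integral_nonneg fun _ => sq_nonneg _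
  linarith

end Projection

/-! ### The viscous dissipation and the final bound -/

section Dissipation

variable {d n N : ℕ} (s : Affine.Simplex ℝ (E d) d)

/-- The viscous dissipation controls the `L²` norm of the LDG gradient. -/
lemma integral_sum_norm_sq_le {K : E d → Fin d → Fin d → Matrix (Fin n) (Fin n) ℝ}
    (hK : ∀ i j a b, IntegrableOn (fun x => K x i j a b) s.closedInterior) {lam : E d → ℝ}
    (hlam : ∀ x ∈ s.closedInterior, 0 < lam x)
    (hLp : MemLp (fun x => (lam x)⁻¹) ⊤ (volume.restrict s.closedInterior))
    (hell : ∀ x ∈ s.closedInterior, ∀ T : Fin d → E n,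
      lam x * ∑ i, ‖T i‖ ^ 2 ≤ dissipationForm (K x) T)
    {Θ : Fin d → E d → E n} (hΘ : ∀ i, Continuous (Θ i)) :
    ∫ x in s.closedInterior, ∑ i, ‖Θ i x‖ ^ 2 ≤
      (eLpNorm (fun x => (lam x)⁻¹) ⊤ (volume.restrict s.closedInterior)).toReal *
        viscousDissipation s K Θ := by
  have hD := measurableSet_closedInterior s
  have hint : IntegrableOn (fun x => dissipationForm (K x) (fun i => Θ i x)) s.closedInterior := by
    simp only [dissipationForm, dotProduct, Matrix.mulVec]
    refine integrable_finsetSum _ fun i _ => integrable_finsetSum _ fun j _ =>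
      integrable_finsetSum _ fun a _ => ?_
    have h1 : IntegrableOn (fun x => ∑ b, K x i j a b * Θ j x b) s.closedInterior :=
      integrable_finsetSum _ fun b _ => (hK i j a b).mul_continuousOn
        (by have := hΘ j; fun_prop) s.isCompact_closedInterior
    exact h1.continuousOn_mul (by have := hΘ i; fun_prop) s.isCompact_closedInterior
  rw [viscousDissipation, ← integral_const_mul]
  refine integral_mono_ae (integrableOn_closedInterior s (by fun_prop)) (hint.const_mul _) ?_
  have hsup := ae_le_eLpNormEssSup (f := fun x => (lam x)⁻¹)
    (μ := volume.restrict s.closedInterior)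
  filter_upwards [hsup, ae_restrict_mem hD] with x hx hxD
  rw [← eLpNorm_exponent_top] at hx
  have hpos := hlam x hxD
  have hle : (lam x)⁻¹ ≤
      (eLpNorm (fun x => (lam x)⁻¹) ⊤ (volume.restrict s.closedInterior)).toReal := by
    have h1 := ENNReal.toReal_mono hLp.eLpNorm_ne_top hx
    rwa [toReal_enorm, Real.norm_eq_abs, abs_of_pos (inv_pos.2 hpos)] at h1
  have hq := hell x hxD (fun i => Θ i x)
  have hnn : 0 ≤ ∑ i, ‖Θ i x‖ ^ 2 := Finset.sum_nonneg fun i _ => by positivity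
  calc ∑ i, ‖Θ i x‖ ^ 2 = (lam x)⁻¹ * (lam x * ∑ i, ‖Θ i x‖ ^ 2) := by field_simp
    _ ≤ (lam x)⁻¹ * dissipationForm (K x) (fun i => Θ i x) :=
        mul_le_mul_of_nonneg_left hq (inv_pos.2 hpos).le
    _ ≤ _ := mul_le_mul_of_nonneg_right hle ((mul_nonneg hpos.le hnn).trans hq)

lemma viscousDissipation_nonneg {K : E d → Fin d → Fin d → Matrix (Fin n) (Fin n) ℝ}
    {lam : E d → ℝ} (hlam : ∀ x ∈ s.closedInterior, 0 < lam x)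
    (hell : ∀ x ∈ s.closedInterior, ∀ T : Fin d → E n,
      lam x * ∑ i, ‖T i‖ ^ 2 ≤ dissipationForm (K x) T) (Θ : Fin d → E d → E n) :
    0 ≤ viscousDissipation s K Θ :=
  setIntegral_nonneg (measurableSet_closedInterior s) fun x hx =>
    (mul_nonneg (hlam x hx).le (Finset.sum_nonneg fun i _ => by positivity)).trans (hell x hx _)

end Dissipation

/-- The arithmetic that combines the estimates: `h² G² ≤ a A`, `Y² ≤ b A`, `A ≤ h² T`, `T ≤ Λ W`
bound the quotient `J X G / W`. -/
lemma quotient_bound {num J X2 Y2 Z2 G2 A T Λ W h a b C : ℝ} (hJ : 0 ≤ J) (hΛ : 0 ≤ Λ)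
    (hW : 0 ≤ W) (hh : 0 < h) (ha : 0 ≤ a) (hC : 0 < C) (habC : a * b ≤ C ^ 2)
    (hG2 : 0 ≤ G2) (hY2 : 0 ≤ Y2) (hA : 0 ≤ A)
    (hnum : num ≤ J * √X2 * √G2) (hX : X2 = Z2 - Y2) (hGA : h ^ 2 * G2 ≤ a * A)
    (hYA : Y2 ≤ b * A) (hAT : A ≤ h ^ 2 * T) (hTW : T ≤ Λ * W) (hYG : Y2 = 0 → G2 = 0) :
    (W = 0 → num ≤ 0) ∧ num / W ≤ C * (Λ * J * √(Z2 / Y2 - 1)) * h := by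
  have hh2 : 0 < h ^ 2 := by positivity
  have hzero : W = 0 → num ≤ 0 := by
    intro hW0
    have hA0 : A = 0 := by
      rw [hW0, mul_zero] at hTW
      nlinarith
    have hG0 : G2 = 0 := by
      rw [hA0, mul_zero] at hGA
      nlinarith
    rw [hG0] at hnum
    simpa using hnum
  refine ⟨hzero, ?_⟩
  have hR : 0 ≤ C * (Λ * J * √(Z2 / Y2 - 1)) * h := by positivity
  -- `W = 0` and `Y2 = 0` are the cases where a quotient takes the value `0` by convention
  rcases hW.eq_or_lt with hW0 | hWpos
  · rw [← hW0, div_zero]; exact hR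
  rcases hY2.eq_or_lt with hY0 | hYpos
  · rw [hYG hY0.symm] at hnum
    exact (div_nonpos_of_nonpos_of_nonneg (by simpa using hnum) hW).trans hR
  have hXY : √(Z2 / Y2 - 1) = √X2 / √Y2 := by
    rw [hX, ← Real.sqrt_div' _ hY2]
    congr 1
    field_simp
  have hsY : 0 < √Y2 := Real.sqrt_pos.2 hYpos
  have hkey : √G2 * √Y2 ≤ C * h * (Λ * W) := by
    have hT : 0 ≤ T := by
      by_contra hneg
      nlinarith
    have h1 : h * (√G2 * √Y2) ≤ C * A := by
      refine le_of_sq_le_sq ?_ (by positivity)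
      rw [mul_pow, mul_pow, Real.sq_sqrt hG2, Real.sq_sqrt hY2]
      calc h ^ 2 * (G2 * Y2) = (h ^ 2 * G2) * Y2 := by ring
        _ ≤ (a * A) * (b * A) := mul_le_mul hGA hYA hY2 (by positivity)
        _ = (a * b) * A ^ 2 := by ring
        _ ≤ C ^ 2 * A ^ 2 := mul_le_mul_of_nonneg_right habC (by positivity)
        _ = (C * A) ^ 2 := by ring
    have h2 : h * (√G2 * √Y2) ≤ h * (C * h * (Λ * W)) := by
      calc h * (√G2 * √Y2) ≤ C * A := h1
        _ ≤ C * (h ^ 2 * (Λ * W)) := mul_le_mul_of_nonneg_left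
            (hAT.trans (mul_le_mul_of_nonneg_left hTW hh2.le)) hC.le
        _ = _ := by ring
    exact le_of_mul_le_mul_left h2 hh
  rw [hXY, div_le_iff₀ hWpos]
  refine hnum.trans ?_
  have h3 : √G2 ≤ C * h * (Λ * W) / √Y2 := (le_div_iff₀ hsY).2 hkey
  calc J * √X2 * √G2 ≤ J * √X2 * (C * h * (Λ * W) / √Y2) :=
        mul_le_mul_of_nonneg_left h3 (by positivity)
    _ = _ := by ring

end ECAV

end

theorem lemma4 (d : ℕ) [NeZero d] (N : ℕ) (σ : ℝ) :
    ∃ C : ℝ, 0 < C ∧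
      ∀ (n : ℕ) (L : ECAV.EntropySystem d n)
        (s : Affine.Simplex ℝ (ECAV.E d) d) (_ : ECAV.ShapeRegular s σ)
        (v₀ : ECAV.E d) (_ : v₀ ≠ 0)
        -- the discrete solution, with admissible values
        (uh : ECAV.E d → ECAV.E n) (_ : ECAV.IsVecPoly N uh)
        (_ : ∀ x ∈ s.closedInterior, uh x ∈ L.states)
        -- the projected entropy variables, joined to the entropy variables within their range
        (vh : ECAV.E d → ECAV.E n)
        (_ : ECAV.IsL2Projection s.closedInterior N (fun x => L.entropyVar (uh x)) vh)
        (_ : ECAV.entropySegments L s uh vh ⊆ L.entropyStates)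
        (_ : ∀ i, BddAbove ((fun w => ‖L.fluxJacobian i w‖) '' ECAV.entropySegments L s uh vh))
        -- the exterior values on the faces and the LDG gradient
        (vext : Fin (d + 1) → ECAV.E d → ECAV.E n)
        (_ : ∀ j, MeasureTheory.Integrable (vext j) (ECAV.faceMeasure s j))
        (Θ : Fin d → ECAV.E d → ECAV.E n) (_ : ECAV.IsLDGGradient s N v₀ vh vext Θ)
        -- the dissipation matrices and their positive lower bound
        (K : ECAV.E d → Fin d → Fin d → Matrix (Fin n) (Fin n) ℝ)
        (_ : ∀ i j a b, MeasureTheory.IntegrableOn (fun x => K x i j a b) s.closedInterior)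
        (lam : ECAV.E d → ℝ) (_ : ∀ x ∈ s.closedInterior, 0 < lam x)
        (_ : MeasureTheory.MemLp (fun x => (lam x)⁻¹) ⊤
          (MeasureTheory.volume.restrict s.closedInterior))
        (_ : ∀ x ∈ s.closedInterior, ∀ T : Fin d → ECAV.E n,
          lam x * ∑ i, ‖T i‖ ^ 2 ≤ ECAV.dissipationForm (K x) T)
        -- the projection of the deviation from the mean
        (pδv : ECAV.E d → ECAV.E n)
        (_ : ECAV.IsL2Projection s.closedInterior N (ECAV.entropyDeviation L s uh) pδv),
        (ECAV.viscousDissipation s K Θ = 0 → min 0 (ECAV.entropyResidual L s uh vh) = 0) ∧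
        ECAV.ecavCoefficient L s K uh vh Θ ≤
          C * ECAV.boundFactor L s lam uh vh pδv * ECAV.elementSize s := by
  open ECAV in
  obtain ⟨B, hB, hbound⟩ := exists_weightedEnergy_bound d N
  have hd : (1 : ℝ) ≤ d := by exact_mod_cast NeZero.one_le
  -- `h² ‖∇v_h‖² ≤ d³ σ² B A` and `‖Π_N δv‖² ≤ B A`, so any `C > 0` with `C² ≥ d³ σ² B²` will do;
  -- `|σ| + 1` keeps it positive whatever the sign of `σ`
  refine ⟨d ^ 2 * (|σ| + 1) * B, by positivity, ?_⟩
  intro n L s hs v₀ hv₀ uh huh hst vh hvh hseg hbdd vext hext Θ hΘ K hK lam hlam hLp hell pδv hpδ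
  obtain ⟨j₀, hj₀⟩ := exists_outflow_face s hv₀
  have hV := continuousOn_entropyVar_comp L s huh.continuous hst
  set c := ⨍ y in s.closedInterior, L.entropyVar (uh y) with hc
  have hδ : ContinuousOn (entropyDeviation L s uh) s.closedInterior := hV.sub continuousOn_const
  have hshift : ∀ x, pδv x = vh x - c := fun x =>
    IsL2Projection.eq_sub_const s hV hvh (q := pδv) hpδ x
  obtain ⟨hgrad, hdev⟩ := hbound n s j₀ vh hvh.1
  have hfin : IsFiniteMeasure (MeasureTheory.volume.restrict s.closedInterior) :=
    ⟨by simpa using volume_closedInterior_lt_top s⟩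
  -- the projection of the deviation has mean zero
  have hmean : ∀ a, ∫ x in s.closedInterior, pδv x a = 0 := by
    intro a
    have h1 := hpδ.2 (fun _ => 1) (ECAV.IsPoly.const N 1) a
    simp only [mul_one] at h1
    rw [h1]
    have h2 := (EuclideanSpace.proj a : E n →L[ℝ] ℝ).integral_comp_comm
      (integrableOn_closedInterior s hδ)
    have h3 : ∫ x in s.closedInterior, entropyDeviation L s uh x = 0 :=
      MeasureTheory.integral_sub_average _ _
    rw [h3, map_zero] at h2
    exact h2
  have hY : normSqL2 s.closedInterior pδv ≤ B * weightedEnergy s j₀ vh := by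
    refine (integral_norm_sq_le_of_mean_zero s hpδ.1.continuous.continuousOn hmean
      (vh (s.points j₀) - c)).trans (le_of_eq_of_le ?_ hdev)
    congr 1
    funext x
    rw [hshift, sub_sub_sub_cancel_right]
  have hX : ∫ x in s.closedInterior, ‖L.entropyVar (uh x) - vh x‖ ^ 2 =
      normSqL2 s.closedInterior (entropyDeviation L s uh) - normSqL2 s.closedInterior pδv := by
    rw [← IsL2Projection.integral_norm_sub_sq s hδ hpδ]
    congr 1
    funext x
    rw [hshift, entropyDeviation, sub_sub_sub_cancel_right]
  have hYG : normSqL2 s.closedInterior pδv = 0 →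
      ∑ i, ∫ x in s.closedInterior, ‖partialDeriv i vh x‖ ^ 2 = 0 := by
    intro h0
    have h1 := hpδ.1.eq_zero_of_integral_eq_zero s h0
    have h2 : vh = fun _ => c := by
      funext x
      have := hshift x
      rw [h1] at this
      exact (sub_eq_zero.1 this.symm)
    simp [h2, partialDeriv]
  have hG := elementSize_sq_mul_sum_integral_le s j₀ hs hvh.1 hgrad
  have hnn : 0 ≤ weightedEnergy s j₀ vh := weightedEnergy_nonneg s j₀ vh
  have key := quotient_bound (num := -min 0 (entropyResidual L s uh vh))
    (J := √(∑ i, fluxJacobianNorm L s uh vh i ^ 2)) (a := d ^ 3 * σ ^ 2 * B) (b := B)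
    (C := d ^ 2 * (|σ| + 1) * B) (Real.sqrt_nonneg _) ENNReal.toReal_nonneg
    (viscousDissipation_nonneg s hlam hell Θ) (elementSize_pos s) (by positivity)
    (by positivity) ?_ (Finset.sum_nonneg fun i _ =>
      MeasureTheory.integral_nonneg fun x => by positivity)
    (MeasureTheory.integral_nonneg fun x => by positivity) hnn
    (neg_min_entropyResidual_le L s huh.continuous hst hvh.1.contDiff hseg hbdd) hX
    (hG.trans_eq (by ring)) hY (weightedEnergy_le s j₀ hj₀ hvh.1 hext hΘ)
    (integral_sum_norm_sq_le s hK hlam hLp hell fun i => (hΘ i).1.continuous) hYG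
  · refine ⟨fun h0 => le_antisymm (min_le_left _ _) ?_, key.2⟩
    linarith [key.1 h0]
  · have h1 : σ ^ 2 ≤ (|σ| + 1) ^ 2 := by
      rw [← sq_abs σ]
      exact pow_le_pow_left₀ (abs_nonneg _) (by linarith) 2
    have h2 : (d : ℝ) ^ 3 ≤ d ^ 4 := pow_le_pow_right₀ hd (by norm_num)
    calc (d : ℝ) ^ 3 * σ ^ 2 * B * B = (d : ℝ) ^ 3 * σ ^ 2 * B ^ 2 := by ring
      _ ≤ (d : ℝ) ^ 4 * (|σ| + 1) ^ 2 * B ^ 2 := by gcongr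
      _ = _ := by ring
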